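/- Let $\mathbb K=\mathbb R$ or $\mathbb C$, let $1\le p<\infty$ and $\ell_p=\ell_p(\mathbb Z_+)$ over $\mathbb K$. Let $u=(u_n)_{n\ge 1}$ and $v=(v_n)_{n\ge1}$ be bounded sequences of non-zero scalars, and let $B_u,B_v$ be the associated weighted backward shifts on $\ell_p$, where $B_we_0=0$ and $B_we_n=w_ne_{n-1}$ for $n\ge 1$. A Borel probability measure $m$ on $\ell_p$ is a *product measure* if it is the restriction to $\ell_p$ of a product $\mu=\bigotimes_{n\ge 0}\mu_n$ of Borel probability measures on $\mathbb K$ with $\mu(\ell_p)=1$; the $\mu_n$ are its marginals. It is a *Gaussian product measure* if moreover each $\mu_n$ is a centered Gaussian measure $\mathcal N(0,\sigma_n^2)$ with covariance matrix $\sigma_n^2I_{\mathbb K}$ for some $\sigma_n>0$. For a property (P) of measures, $B_u$ and $B_v$ are *orthogonal with respect to measures satisfying* (P) if every $B_u$-invariant Borel probability measure satisfying (P) and every $B_v$-invariant Borel probability measure satisfying (P) are mutually singular. Consider the following properties. (a) $B_u$ and $B_v$ are not orthogonal with respect to product measures all of whose marginals are absolutely continuous with respect to Lebesgue measure on $\mathbb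 K$. (b) $B_u$ and $B_v$ are not orthogonal with respect to product measures all of whose marginals $\mu_n$ satisfy $\mu_n(\{0\})=0$ and $\log|t|\in L_2(\mu_n)$. (c) There exists $\kappa>0$ such that $\displaystyle\sum_{n=1}^\infty\left(1-\kappa\left|\frac{u_1\cdots u_n}{v_1\cdots v_n}\right|\right)^2<\infty$. (d) There are a $B_u$-invariant Gaussian product measure $m_u$ and a $B_v$-invariant Gaussian product measure $m_v$ on $\ell_p$ which are equivalent, i.e. $m_u\ll m_v$ and $m_v\ll m_u$. If $\displaystyle\sum_{n=1}^\infty\frac1{|u_1\cdots u_n|^p}<\infty$ and $\displaystyle\sum_{n=1}^\infty\frac1{|v_1\cdots v_n|^p}<\infty$, then (a), (b), (c) and (d) are equivalent. Without these two summability assumptions, (a), (b) and (d) are still equivalent, and they imply (c). -/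

import Mathlib

open MeasureTheory ProbabilityTheory
open scoped ENNReal

/-- The sequence space `ℓ_p(ℤ₊)` over the scalar field `𝕜` (`ℝ` or `ℂ`). -/
abbrev Ellp (𝕜 : Type*) [RCLike 𝕜] (p : ℝ≥0∞) := lp (fun _ : ℕ => 𝕜) p

/-- `ℓ_p` carries the Borel σ-algebra of its norm topology. -/
noncomputable instance Ellp.instMeasurableSpace (𝕜 : Type*) [RCLike 𝕜] (p : ℝ≥0∞) [Fact (1 ≤ p)] :
    MeasurableSpace (Ellp 𝕜 p) := borel _

instance Ellp.instBorelSpace (𝕜 : Type*) [RCLike 𝕜] (p : ℝ≥0∞) [Fact (1 ≤ p)] :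
    BorelSpace (Ellp 𝕜 p) := ⟨rfl⟩

/-- `(w_n)_{n ≥ 1}` is a bounded sequence of non-zero scalars; the value `w 0` is not used. -/
structure IsWeightSequence {𝕜 : Type*} [RCLike 𝕜] (w : ℕ → 𝕜) : Prop where
  ne_zero : ∀ n, 1 ≤ n → w n ≠ 0
  bounded : ∃ C : ℝ, ∀ n, 1 ≤ n → ‖w n‖ ≤ C

/-- The partial product `w_1 ⋯ w_n`. -/
def weightProd {𝕜 : Type*} [RCLike 𝕜] (w : ℕ → 𝕜) (n : ℕ) : 𝕜 := ∏ k ∈ Finset.Icc 1 n, w k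

theorem weightedShift_bound {𝕜 : Type*} [RCLike 𝕜] {p : ℝ≥0∞} [Fact (1 ≤ p)] {w : ℕ → 𝕜}
    {C : ℝ} (hC : ∀ n, 1 ≤ n → ‖w n‖ ≤ C) (x : Ellp 𝕜 p) :
    ∃ h : Memℓp (fun n : ℕ => w (n + 1) * x (n + 1)) p,
      ‖(⟨fun n : ℕ => w (n + 1) * x (n + 1), h⟩ : Ellp 𝕜 p)‖ ≤ C * ‖x‖ := by
  have hC0 : 0 ≤ C := (norm_nonneg _).trans (hC 1 le_rfl)
  have hle : ∀ n, ‖w (n + 1) * x (n + 1)‖ ≤ C * ‖x (n + 1)‖ := fun n => by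
    rw [norm_mul]; exact mul_le_mul_of_nonneg_right (hC _ (by omega)) (norm_nonneg _)
  have hp1 : 1 ≤ p := Fact.out
  rcases eq_or_ne p ⊤ with hp | hp
  · subst hp
    have hb : ∀ n, ‖w (n + 1) * x (n + 1)‖ ≤ C * ‖x‖ := fun n =>
      (hle n).trans (mul_le_mul_of_nonneg_left (lp.norm_apply_le_norm (by simp) x _) hC0)
    refine ⟨memℓp_infty ⟨C * ‖x‖, ?_⟩, lp.norm_le_of_forall_le (by positivity) hb⟩
    rintro _ ⟨n, rfl⟩
    exact hb n
  · have hp0 : 0 < p.toReal := ENNReal.toReal_pos (by positivity) hp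
    have hs : ∀ s : Finset ℕ, ∑ n ∈ s, ‖w (n + 1) * x (n + 1)‖ ^ p.toReal
        ≤ (C * ‖x‖) ^ p.toReal := by
      intro s
      calc ∑ n ∈ s, ‖w (n + 1) * x (n + 1)‖ ^ p.toReal
          ≤ ∑ n ∈ s, C ^ p.toReal * ‖x (n + 1)‖ ^ p.toReal := by
            refine Finset.sum_le_sum fun n _ => ?_
            rw [← Real.mul_rpow hC0 (norm_nonneg _)]
            exact Real.rpow_le_rpow (norm_nonneg _) (hle n) hp0.le
        _ = C ^ p.toReal * ∑ n ∈ s.map (addRightEmbedding 1), ‖x n‖ ^ p.toReal := by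
            rw [Finset.sum_map, Finset.mul_sum]; rfl
        _ ≤ C ^ p.toReal * ‖x‖ ^ p.toReal :=
            mul_le_mul_of_nonneg_left (lp.sum_rpow_le_norm_rpow hp0 x _) (by positivity)
        _ = (C * ‖x‖) ^ p.toReal := (Real.mul_rpow hC0 (norm_nonneg _)).symm
    exact ⟨memℓp_gen' hs, lp.norm_le_of_forall_sum_le hp0 (by positivity) hs⟩

/-- The weighted backward shift `B_w` on `ℓ_p`: the bounded operator with `B_w e_0 = 0` and
`B_w e_n = w_n e_{n-1}` for `n ≥ 1`, that is `(B_w x)_n = w_{n+1} x_{n+1}`. -/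
noncomputable def weightedShift {𝕜 : Type*} [RCLike 𝕜] (p : ℝ≥0∞) [Fact (1 ≤ p)] (w : ℕ → 𝕜)
    (hw : IsWeightSequence w) : Ellp 𝕜 p →L[𝕜] Ellp 𝕜 p :=
  LinearMap.mkContinuousOfExistsBound
    { toFun := fun x => ⟨fun n : ℕ => w (n + 1) * x (n + 1),
        (weightedShift_bound hw.bounded.choose_spec x).choose⟩
      map_add' := fun x y => by
        ext n; exact mul_add (w (n + 1)) (x (n + 1)) (y (n + 1))
      map_smul' := fun c x => by
        ext n; exact mul_left_comm (w (n + 1)) c (x (n + 1)) }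
    ⟨hw.bounded.choose, fun x => (weightedShift_bound hw.bounded.choose_spec x).choose_spec⟩

theorem weightedShift_apply {𝕜 : Type*} [RCLike 𝕜] (p : ℝ≥0∞) [Fact (1 ≤ p)] (w : ℕ → 𝕜)
    (hw : IsWeightSequence w) (x : Ellp 𝕜 p) (n : ℕ) :
    weightedShift p w hw x n = w (n + 1) * x (n + 1) := rfl

/-- `T₁` and `T₂` are orthogonal with respect to measures satisfying `P`: any `T₁`-invariant and
any `T₂`-invariant Borel probability measure which both satisfy `P` are mutually singular. -/
def OrthogonalWrt {X : Type*} [MeasurableSpace X] (P : Measure X → Prop) (T₁ T₂ : X → X) : Prop :=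
  ∀ m₁ m₂ : Measure X, IsProbabilityMeasure m₁ → IsProbabilityMeasure m₂ →
    MeasurePreserving T₁ m₁ m₁ → MeasurePreserving T₂ m₂ m₂ → P m₁ → P m₂ → m₁ ⟂ₘ m₂

/-- The inclusion of `ℓ_p` into the product space `𝕜^{ℤ₊}`. -/
def ellpIncl (𝕜 : Type*) [RCLike 𝕜] (p : ℝ≥0∞) (x : Ellp 𝕜 p) : ℕ → 𝕜 := fun n => x n

theorem measurable_ellpIncl (𝕜 : Type*) [RCLike 𝕜] (p : ℝ≥0∞) [Fact (1 ≤ p)] :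
    Measurable (ellpIncl 𝕜 p) := by
  refine measurable_pi_lambda _ fun n => Continuous.measurable ?_
  exact (continuous_apply n).comp (lp.uniformContinuous_coe (E := fun _ : ℕ => 𝕜)).continuous

/-- `m` is a product measure on `ℓ_p` whose marginals all satisfy `Q`: regarded as a measure on
`𝕜^{ℤ₊}` (by pushing it forward along the inclusion), `m` is the product `⨂ μ_n` of Borel
probability measures `μ_n` on `𝕜`, each of which satisfies `Q`. -/
def IsProductMeasureWith {𝕜 : Type*} [RCLike 𝕜] {p : ℝ≥0∞} [Fact (1 ≤ p)]
    (Q : Measure 𝕜 → Prop) (m : Measure (Ellp 𝕜 p)) : Prop :=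
  ∃ (μ : ℕ → Measure 𝕜) (_ : ∀ n, IsProbabilityMeasure (μ n)),
    m.map (ellpIncl 𝕜 p) = Measure.infinitePi μ ∧ ∀ n, Q (μ n)

/-- Absolute continuity with respect to Lebesgue measure on `𝕜` (one-dimensional if `𝕜 = ℝ`,
planar if `𝕜 = ℂ`); here `volume` is the one of `𝕜` as a real Euclidean space. -/
def IsLebesgueAC {𝕜 : Type*} [RCLike 𝕜] (μ : Measure 𝕜) : Prop := μ ≪ (volume : Measure 𝕜)

/-- `μ` does not charge `{0}` and `log |t|` belongs to `L₂(μ)`. -/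
def IsLogL2 {𝕜 : Type*} [RCLike 𝕜] (μ : Measure 𝕜) : Prop :=
  μ {0} = 0 ∧ MemLp (fun t : 𝕜 => Real.log ‖t‖) 2 μ

/-- `μ` is the centered Gaussian measure `𝒩(0, σ²)` on `𝕜`, with covariance matrix `σ² I_𝕜`, for
some `σ > 0`: the image of the standard Gaussian measure of the real Euclidean space `𝕜` under
`t ↦ σ t`. -/
def IsCenteredIsotropicGaussian {𝕜 : Type*} [RCLike 𝕜] (μ : Measure 𝕜) : Prop :=
  ∃ σ : ℝ, 0 < σ ∧ μ = (stdGaussian 𝕜).map (fun t : 𝕜 => σ • t)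

/-- `T₁` and `T₂` admit equivalent (mutually absolutely continuous) invariant Gaussian product
measures on `ℓ_p`. -/
def AdmitEquivalentGaussianProducts {𝕜 : Type*} [RCLike 𝕜] {p : ℝ≥0∞} [Fact (1 ≤ p)]
    (T₁ T₂ : Ellp 𝕜 p → Ellp 𝕜 p) : Prop :=
  ∃ m₁ m₂ : Measure (Ellp 𝕜 p), IsProbabilityMeasure m₁ ∧ IsProbabilityMeasure m₂ ∧
    MeasurePreserving T₁ m₁ m₁ ∧ MeasurePreserving T₂ m₂ m₂ ∧
    IsProductMeasureWith IsCenteredIsotropicGaussian m₁ ∧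
    IsProductMeasureWith IsCenteredIsotropicGaussian m₂ ∧
    m₁ ≪ m₂ ∧ m₂ ≪ m₁

/-- There is `κ > 0` such that `∑_{n ≥ 1} (1 - κ |u_1 ⋯ u_n / v_1 ⋯ v_n|)² < ∞`. -/
def SquareSummableRatio {𝕜 : Type*} [RCLike 𝕜] (u v : ℕ → 𝕜) : Prop :=
  ∃ κ : ℝ, 0 < κ ∧
    Summable fun n : ℕ => (1 - κ * ‖weightProd u (n + 1) / weightProd v (n + 1)‖) ^ 2

/-- `∑_{n ≥ 1} 1 / |w_1 ⋯ w_n|^p < ∞`. -/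
def InvProdSummable {𝕜 : Type*} [RCLike 𝕜] (p : ℝ≥0∞) (w : ℕ → 𝕜) : Prop :=
  Summable fun n : ℕ => 1 / ‖weightProd w (n + 1)‖ ^ p.toReal

open Filter Topology

/-! ### Integrals of products and Chebyshev's inequality under infinite product measures -/

/-! If a product measure is invariant under `B_w`, multiplication by `w_1 ⋯ w_n` carries its `n`-th
marginal to its first one. This rigidity reduces everything to the first marginals and to the
numbers `r_n = |u_1 ⋯ u_n / v_1 ⋯ v_n|`.

Necessity. Let `⨂ μ_n` and `⨂ ν_n` be invariant and not mutually singular. The function `log |u_1 ⋯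
u_n t|` has a fixed law `l` under `μ_n`, and under `ν_n` a fixed law `l'` translated by `log r_n`;
the translation makes sense because (a) and (b) both forbid mass at `0`. By Chebyshev's inequality
(`mutuallySingular_infinitePi_of_not_summable`), non-singularity makes the differences of the means
of any bounded test function square summable. Testing on a cosine and a sine gives `∑ (log r_n - a)²
< ∞` for some `a` (`exists_summable_sub_sq_of_translates`), which is (c) with `κ = exp (-a)`.
Moreover, an invariant measure carried by `ℓ_p` forces the inverse products to be `p`-summable
(`invProdSummable_of_invariant`), so non-orthogonality provides the summability assumptions by
itself.

Sufficiency. Given summability, the Gaussian products with deviations `1 / |u_1 ⋯ u_n|` and `κ /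
|v_1 ⋯ v_n|` live on `ℓ_p` and are invariant. Their Hellinger affinities are explicit, and (c) makes
them equivalent by Kakutani's criterion (`infinitePi_absolutelyContinuous`). Gaussian marginals
satisfy the requirements of both (a) and (b), which closes the cycle. -/

theorem integral_infinitePi_finset_prod {ι E : Type*} [MeasurableSpace E] (P : ι → Measure E)
    [∀ n, IsProbabilityMeasure (P n)] {f : ι → E → ℝ} (hf : ∀ n, Measurable (f n))
    (s : Finset ι) :
    ∫ x, ∏ i ∈ s, f i (x i) ∂Measure.infinitePi P = ∏ i ∈ s, ∫ t, f i t ∂P i := by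
  have hind : iIndepFun (fun (i : s) (x : ι → E) => f i (x i)) (Measure.infinitePi P) :=
    (iIndepFun_infinitePi hf).precomp Subtype.val_injective
  have h := hind.integral_fun_prod_eq_prod_integral
    (fun i => ((hf i).comp (measurable_pi_apply _)).aestronglyMeasurable)
  have h2 : ∀ i, ∫ x : ι → E, f i (x i) ∂Measure.infinitePi P = ∫ t, f i t ∂P i := fun i => by
    rw [← Measure.infinitePi_map_eval P i, integral_map (measurable_pi_apply i).aemeasurable
      (hf i).aestronglyMeasurable]
  simp only [h2] at h
  rw [← Finset.prod_coe_sort s (fun i => ∫ t, f i t ∂P i), ← h]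
  congr 1 with x
  exact (Finset.prod_coe_sort s (fun i => f i (x i))).symm

theorem integral_comp_eval_infinitePi {ι E : Type*} [MeasurableSpace E] (P : ι → Measure E)
    [∀ n, IsProbabilityMeasure (P n)] {f : E → ℝ} (hf : Measurable f) (i : ι) :
    ∫ x : ι → E, f (x i) ∂Measure.infinitePi P = ∫ t, f t ∂P i := by
  rw [← Measure.infinitePi_map_eval P i, integral_map (measurable_pi_apply i).aemeasurable
    hf.aestronglyMeasurable]

/-- Chebyshev's inequality: the summands are independent and lie in `[-|d i|, |d i|]`, so the
variance is at most `∑ d i ^ 2`. In the application `d i` is the gap between two means, so the same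
sum is also the gap between the two expectations. -/
theorem infinitePi_deviation_le {ι E : Type*} [MeasurableSpace E] (P : ι → Measure E)
    [∀ n, IsProbabilityMeasure (P n)] {h : ι → E → ℝ} (hm : ∀ n, Measurable (h n))
    (hb : ∀ n t, |h n t| ≤ 1) (d : ι → ℝ) (s : Finset ι) (hA : 0 < ∑ i ∈ s, d i ^ 2) :
    Measure.infinitePi P {x | (∑ i ∈ s, d i ^ 2) / 2 ≤
        |∑ i ∈ s, d i * h i (x i) - ∑ i ∈ s, d i * ∫ t, h i t ∂P i|}
      ≤ ENNReal.ofReal (4 / ∑ i ∈ s, d i ^ 2) := by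
  set A := ∑ i ∈ s, d i ^ 2 with hAdef
  set Q := Measure.infinitePi P
  set X : ι → (ι → E) → ℝ := fun i x => d i * h i (x i) with hX
  have hXm : ∀ i, Measurable (X i) := fun i =>
    ((hm i).comp (measurable_pi_apply i)).const_mul _
  have hXb : ∀ i x, X i x ∈ Set.Icc (-|d i|) (|d i|) := fun i x => by
    rw [Set.mem_Icc, ← abs_le, hX]
    simp only [abs_mul]
    exact mul_le_of_le_one_right (abs_nonneg _) (hb _ _)
  have hL : ∀ i, MemLp (X i) 2 Q := fun i =>
    memLp_of_bounded (ae_of_all _ (hXb i)) (hXm i).aestronglyMeasurable _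
  have hind : iIndepFun X Q :=
    iIndepFun_infinitePi (X := fun i t => d i * h i t) fun i => (hm i).const_mul _
  have hvar : Var[∑ i ∈ s, X i; Q] ≤ A := by
    rw [IndepFun.variance_sum (fun i _ => hL i) fun i _ j _ hij => hind.indepFun hij]
    refine Finset.sum_le_sum fun i _ => ?_
    refine (variance_le_sq_of_bounded (ae_of_all _ (hXb i)) (hXm i).aemeasurable).trans ?_
    rw [sub_neg_eq_add, add_self_div_two, sq_abs]
  have hmean : ∫ x, (∑ i ∈ s, X i) x ∂Q = ∑ i ∈ s, d i * ∫ t, h i t ∂P i := by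
    simp only [Finset.sum_apply]
    rw [integral_finsetSum _ fun i _ => (hL i).integrable (by norm_num)]
    refine Finset.sum_congr rfl fun i _ => ?_
    rw [hX, integral_const_mul, integral_comp_eval_infinitePi P (hm i)]
  have hS : MemLp (∑ i ∈ s, X i) 2 Q := memLp_finsetSum' s fun i _ => hL i
  have key := meas_ge_le_variance_div_sq hS (half_pos hA)
  rw [hmean] at key
  simp only [Finset.sum_apply, hX] at key
  refine key.trans (ENNReal.ofReal_le_ofReal ?_)
  calc Var[∑ i ∈ s, X i; Q] / (A / 2) ^ 2 ≤ A / (A / 2) ^ 2 := by gcongr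
    _ = 4 / A := by field_simp; norm_num

/-- Borel–Cantelli along `ε = 2⁻ⁿ`: both limsup sets are null for the respective measures, and they
cover the space because every point is infinitely often in `S` or infinitely often in its
complement. -/
theorem mutuallySingular_of_forall_exists {Ω : Type*} [MeasurableSpace Ω] {μ ν : Measure Ω}
    (h : ∀ ε : ℝ, 0 < ε → ∃ S : Set Ω, μ Sᶜ ≤ ENNReal.ofReal ε ∧ ν S ≤ ENNReal.ofReal ε) :
    μ ⟂ₘ ν := by
  choose! S hμ hν using h
  set ε : ℕ → ℝ := fun n => (1 / 2) ^ n with hε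
  have hpos : ∀ n, 0 < ε n := fun n => by positivity
  have hsum : ∑' n, ENNReal.ofReal (ε n) ≠ ∞ :=
    summable_geometric_two.tsum_ofReal_ne_top
  refine Measure.MutuallySingular.mk (s := limsup (fun n => (S (ε n))ᶜ) atTop)
    (t := limsup (fun n => S (ε n)) atTop) ?_ ?_ ?_
  · exact measure_limsup_atTop_eq_zero
      (ne_top_of_le_ne_top hsum (ENNReal.tsum_le_tsum fun n => hμ _ (hpos n)))
  · exact measure_limsup_atTop_eq_zero
      (ne_top_of_le_ne_top hsum (ENNReal.tsum_le_tsum fun n => hν _ (hpos n)))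
  · intro x _
    rw [Set.mem_union, mem_limsup_iff_frequently_mem, mem_limsup_iff_frequently_mem,
      ← frequently_or_distrib]
    exact (Eventually.of_forall fun n => (em (x ∈ S (ε n))).symm).frequently

/-- Two infinite product measures are mutually singular as soon as the means of some uniformly
bounded functions of the coordinates differ by a sequence which is not square summable. -/
theorem mutuallySingular_infinitePi_of_not_summable {E : Type*} [MeasurableSpace E]
    (P Q : ℕ → Measure E) [∀ n, IsProbabilityMeasure (P n)] [∀ n, IsProbabilityMeasure (Q n)]
    {h : ℕ → E → ℝ} (hm : ∀ n, Measurable (h n)) (hb : ∀ n t, |h n t| ≤ 1)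
    (hns : ¬ Summable fun n => (∫ t, h n t ∂P n - ∫ t, h n t ∂Q n) ^ 2) :
    Measure.infinitePi P ⟂ₘ Measure.infinitePi Q := by
  set d : ℕ → ℝ := fun n => ∫ t, h n t ∂P n - ∫ t, h n t ∂Q n with hd
  have htend := (not_summable_iff_tendsto_nat_atTop_of_nonneg fun n => sq_nonneg (d n)).1 hns
  refine mutuallySingular_of_forall_exists fun ε hε => ?_
  obtain ⟨N, hN⟩ := (htend.eventually_ge_atTop (4 / ε)).exists
  set s := Finset.range N
  set A := ∑ i ∈ s, d i ^ 2 with hA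
  have hApos : 0 < A := lt_of_lt_of_le (by positivity) hN
  have hle : ENNReal.ofReal (4 / A) ≤ ENNReal.ofReal ε :=
    ENNReal.ofReal_le_ofReal (by rw [div_le_iff₀ hApos]; rw [div_le_iff₀ hε] at hN; linarith)
  have hdiff : ∑ i ∈ s, d i * ∫ t, h i t ∂P i - ∑ i ∈ s, d i * ∫ t, h i t ∂Q i = A := by
    rw [← Finset.sum_sub_distrib, hA]
    exact Finset.sum_congr rfl fun i _ => by simp only [hd]; ring
  -- The linear statistic is cut midway between its two means, which differ by `A`.
  refine ⟨{x | ∑ i ∈ s, d i * ∫ t, h i t ∂P i - A / 2 < ∑ i ∈ s, d i * h i (x i)}, ?_, ?_⟩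
  · refine (measure_mono fun x hx => ?_).trans
      ((infinitePi_deviation_le P hm hb d s hApos).trans hle)
    simp only [Set.mem_compl_iff, Set.mem_ofPred_eq, not_lt] at hx ⊢
    rw [abs_sub_comm]
    exact le_trans (by linarith) (le_abs_self _)
  · refine (measure_mono fun x hx => ?_).trans
      ((infinitePi_deviation_le Q hm hb d s hApos).trans hle)
    simp only [Set.mem_ofPred_eq] at hx ⊢
    exact le_trans (by linarith) (le_abs_self _)

/-! ### Kakutani's criterion for absolute continuity of infinite product measures -/

theorem norm_sq_toLp_two {Ω : Type*} [MeasurableSpace Ω] {μ : Measure Ω} {f : Ω → ℝ}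
    (hf : MemLp f 2 μ) : ‖hf.toLp f‖ ^ 2 = ∫ x, f x ^ 2 ∂μ := by
  rw [← real_inner_self_eq_norm_sq, L2.inner_def]
  refine integral_congr_ae ?_
  filter_upwards [hf.coeFn_toLp] with x hx
  rw [hx, real_inner_self_eq_norm_sq, Real.norm_eq_abs, sq_abs]

theorem norm_sq_Lp_two {Ω : Type*} [MeasurableSpace Ω] {μ : Measure Ω} (F : Lp ℝ 2 μ) :
    ‖F‖ ^ 2 = ∫ x, F x ^ 2 ∂μ := by
  rw [← norm_sq_toLp_two (Lp.memLp F), Lp.toLp_coeFn]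

/-- Completeness of `L²` gives `g`; restriction to `A` is continuous on `L²`, so the norms converge
over every set. -/
theorem exists_tendsto_setIntegral_sq {Ω : Type*} [MeasurableSpace Ω] {μ : Measure Ω}
    {f : ℕ → Ω → ℝ} (hf : ∀ n, MemLp (f n) 2 μ) {c : ℕ → ℝ} (hc : Tendsto c atTop (𝓝 0))
    (hfc : ∀ M N, M ≤ N → ∫ x, (f N x - f M x) ^ 2 ∂μ ≤ c M) :
    ∃ g : Ω → ℝ, MemLp g 2 μ ∧
      ∀ A : Set Ω, Tendsto (fun n => ∫ x in A, f n x ^ 2 ∂μ) atTop (𝓝 (∫ x in A, g x ^ 2 ∂μ)) := by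
  set F : ℕ → Lp ℝ 2 μ := fun n => (hf n).toLp (f n) with hF
  have hcauchy : CauchySeq F := by
    refine cauchySeq_of_le_tendsto_0' (fun n => Real.sqrt (c n)) (fun M N hMN => ?_) ?_
    · rw [dist_comm, dist_eq_norm]
      refine Real.le_sqrt_of_sq_le ?_
      rw [hF, ← MemLp.toLp_sub, norm_sq_toLp_two]
      exact hfc M N hMN
    · simpa [Function.comp_def] using (Real.continuous_sqrt.tendsto 0).comp hc
  obtain ⟨G, hG⟩ := cauchySeq_tendsto_of_complete hcauchy
  refine ⟨G, Lp.memLp G, fun A => ?_⟩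
  have key : ∀ H : Lp ℝ 2 μ,
      ‖LpToLpRestrictCLM Ω ℝ ℝ μ 2 A H‖ ^ 2 = ∫ x in A, H x ^ 2 ∂μ := fun H => by
    rw [norm_sq_Lp_two]
    refine integral_congr_ae ?_
    filter_upwards [LpToLpRestrictCLM_coeFn ℝ A H] with x hx
    rw [hx]
  have h1 := (((LpToLpRestrictCLM Ω ℝ ℝ μ 2 A).continuous.tendsto G).comp hG).norm.pow 2
  rw [key G] at h1
  refine h1.congr fun n => ?_
  rw [Function.comp_apply, key]
  refine integral_congr_ae (ae_restrict_of_ae ?_)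
  filter_upwards [(hf n).coeFn_toLp] with x hx
  rw [hx]

theorem integral_sub_sq {Ω : Type*} [MeasurableSpace Ω] {μ : Measure Ω} {f g : Ω → ℝ}
    (hf : MemLp f 2 μ) (hg : MemLp g 2 μ) :
    ∫ x, (f x - g x) ^ 2 ∂μ = ∫ x, f x ^ 2 ∂μ - 2 * ∫ x, f x * g x ∂μ + ∫ x, g x ^ 2 ∂μ := by
  have hfg : Integrable (fun x => 2 * (f x * g x)) μ := (hf.integrable_mul hg).const_mul 2
  have h1 : Integrable (fun x => f x ^ 2 - 2 * (f x * g x)) μ := hf.integrable_sq.sub hfg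
  rw [← integral_const_mul, ← integral_sub hf.integrable_sq hfg,
    ← integral_add h1 hg.integrable_sq]
  congr 1 with x
  ring

/-- Weierstrass' product inequality. It bounds products of affinities below through the tails of `∑
(1 - θ n)`. -/
theorem one_sub_sum_le_prod {ι : Type*} (s : Finset ι) {a : ι → ℝ} (h0 : ∀ i, 0 ≤ a i)
    (h1 : ∀ i, a i ≤ 1) : 1 - ∑ i ∈ s, (1 - a i) ≤ ∏ i ∈ s, a i := by
  classical
  induction s using Finset.induction_on with
  | empty => simp
  | insert j s hj ih =>
    rw [Finset.sum_insert hj, Finset.prod_insert hj]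
    have hp : ∏ i ∈ s, a i ≤ 1 := Finset.prod_le_one (fun i _ => h0 i) fun i _ => h1 i
    nlinarith [mul_nonneg (sub_nonneg.2 (h1 j)) (sub_nonneg.2 hp)]

theorem setIntegral_sq_eq_measureReal {E : Type*} [MeasurableSpace E] {P Q : Measure E}
    [IsProbabilityMeasure P] {g : E → ℝ} (hg : Measurable g)
    (hPQ : P = Q.withDensity fun t => ENNReal.ofReal (g t ^ 2)) {t : Set E}
    (ht : MeasurableSet t) : ∫ x in t, g x ^ 2 ∂Q = P.real t := by
  rw [integral_eq_lintegral_of_nonneg_ae (ae_of_all _ fun _ => sq_nonneg _)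
    (hg.pow_const 2).aestronglyMeasurable, ← withDensity_apply _ ht, ← hPQ]
  rfl

/-- If `P n` has density `g n ^ 2` with respect to `Q n` and the Hellinger affinities `∫ g n` are
summably close to `1`, then the product of the `P n` is absolutely continuous with respect to the
product of the `Q n`. -/
theorem infinitePi_absolutelyContinuous {E : Type*} [MeasurableSpace E]
    (P Q : ℕ → Measure E) [∀ n, IsProbabilityMeasure (P n)] [∀ n, IsProbabilityMeasure (Q n)]
    {g : ℕ → E → ℝ} (hg : ∀ n, Measurable (g n)) (hg0 : ∀ n t, 0 ≤ g n t)
    (hPQ : ∀ n, P n = (Q n).withDensity fun t => ENNReal.ofReal (g n t ^ 2))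
    (hsum : Summable fun n => 1 - ∫ t, g n t ∂Q n) :
    Measure.infinitePi P ≪ Measure.infinitePi Q := by
  set ν := Measure.infinitePi Q with hν
  have hsq : ∀ n, ∫ t, g n t ^ 2 ∂Q n = 1 := fun n => by
    have := setIntegral_sq_eq_measureReal (hg n) (hPQ n) MeasurableSet.univ
    simpa using this
  have hgL : ∀ n, MemLp (g n) 2 (Q n) := fun n => by
    rw [memLp_two_iff_integrable_sq (hg n).aestronglyMeasurable]
    exact Integrable.of_integral_ne_zero (by rw [hsq]; exact one_ne_zero)
  set θ : ℕ → ℝ := fun n => ∫ t, g n t ∂Q n with hθ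
  have hθ0 : ∀ n, 0 ≤ θ n := fun n => integral_nonneg (hg0 n)
  have hθ1 : ∀ n, θ n ≤ 1 := fun n => by
    have h0 : 0 ≤ ∫ t, (1 - g n t) ^ 2 ∂Q n := integral_nonneg fun t => sq_nonneg _
    rw [integral_sub_sq (f := fun _ => 1) (memLp_const _) (hgL n), hsq] at h0
    simp only [one_pow, one_mul, integral_const, probReal_univ, smul_eq_mul] at h0
    simp only [hθ]; linarith
  set f : ℕ → (ℕ → E) → ℝ := fun N x => ∏ i ∈ Finset.range N, g i (x i) with hf
  have hfm : ∀ N, Measurable (f N) := fun N =>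
    Finset.measurable_prod _ fun i _ => (hg i).comp (measurable_pi_apply i)
  have hfsq : ∀ N, ∫ x, f N x ^ 2 ∂ν = 1 := fun N => by
    simp only [hf, ← Finset.prod_pow]
    rw [integral_infinitePi_finset_prod Q (f := fun i t => g i t ^ 2)
      fun i => (hg i).pow_const 2]
    exact Finset.prod_eq_one fun i _ => hsq i
  have hfL : ∀ N, MemLp (f N) 2 ν := fun N => by
    rw [memLp_two_iff_integrable_sq (hfm N).aestronglyMeasurable]
    exact Integrable.of_integral_ne_zero (by rw [hfsq]; exact one_ne_zero)
  -- The first `M` factors occur squared and integrate to `1`; only the affinities from `M` on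
  -- survive. As the `f N` are unit vectors, this makes them Cauchy in `L²`.
  have hcross : ∀ M k, ∫ x, f (M + k) x * f M x ∂ν = ∏ i ∈ Finset.range k, θ (M + i) := by
    intro M k
    set q : ℕ → E → ℝ := fun i t => if i < M then g i t ^ 2 else g i t with hq
    have hqm : ∀ i, Measurable (q i) := fun i => by
      by_cases hi : i < M
      · simp only [hq, hi, if_true]; exact (hg i).pow_const 2
      · simp only [hq, hi, if_false]; exact hg i
    have h1 : ∀ x, f (M + k) x * f M x = ∏ i ∈ Finset.range (M + k), q i (x i) := fun x => by
      simp only [hf, Finset.prod_range_add]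
      rw [mul_right_comm, ← Finset.prod_mul_distrib]
      congr 1
      · refine Finset.prod_congr rfl fun i hi => ?_
        simp only [hq, Finset.mem_range.1 hi, if_true]; ring
      · refine Finset.prod_congr rfl fun i _ => ?_
        simp [hq]
    simp only [h1]
    rw [integral_infinitePi_finset_prod Q hqm, Finset.prod_range_add]
    have h2 : ∏ i ∈ Finset.range M, ∫ t, q i t ∂Q i = 1 :=
      Finset.prod_eq_one fun i hi => by
        simp only [hq, Finset.mem_range.1 hi, if_true, hsq]
    rw [h2, one_mul]
    exact Finset.prod_congr rfl fun i _ => by simp [hq, hθ]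
  obtain ⟨F, hFL, hF⟩ := exists_tendsto_setIntegral_sq hfL
    (c := fun M => 2 * ∑' i, (1 - θ (i + M)))
    (by simpa using (tendsto_sum_nat_add fun n => 1 - θ n).const_mul 2)
    (fun M N hMN => by
      obtain ⟨k, rfl⟩ := Nat.exists_eq_add_of_le hMN
      rw [integral_sub_sq (hfL _) (hfL _), hfsq, hfsq, hcross]
      have h1 := one_sub_sum_le_prod (Finset.range k) (a := fun i => θ (M + i))
        (fun i => hθ0 _) fun i => hθ1 _
      have h2 : ∑ i ∈ Finset.range k, (1 - θ (M + i)) ≤ ∑' i, (1 - θ (i + M)) := by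
        simp only [add_comm M]
        exact ((summable_nat_add_iff M).2 hsum).sum_le_tsum _
          fun i _ => sub_nonneg.2 (hθ1 _)
      linarith)
  have hbox : ∀ (N : ℕ) (t : ℕ → Set E), (∀ i, MeasurableSet (t i)) →
      ∫ x in Set.pi (Finset.range N) t, f N x ^ 2 ∂ν
        = ∏ i ∈ Finset.range N, (P i).real (t i) := by
    intro N t ht
    rw [← integral_indicator (MeasurableSet.pi (Set.to_countable _) fun i _ => ht i)]
    have h1 : ∀ x, (Set.pi (Finset.range N) t).indicator (fun x => f N x ^ 2) x
        = ∏ i ∈ Finset.range N, (t i).indicator (fun s => g i s ^ 2) (x i) := fun x => by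
      by_cases hx : x ∈ Set.pi (Finset.range N : Set ℕ) t
      · rw [Set.indicator_of_mem hx]
        simp only [hf, ← Finset.prod_pow]
        exact Finset.prod_congr rfl fun i hi =>
          (Set.indicator_of_mem (hx i hi) fun s => g i s ^ 2).symm
      · rw [Set.indicator_of_notMem hx]
        simp only [Set.mem_pi, not_forall] at hx
        obtain ⟨i, hi, hxi⟩ := hx
        exact (Finset.prod_eq_zero hi (Set.indicator_of_notMem hxi _)).symm
    simp only [h1]
    rw [integral_infinitePi_finset_prod Q (f := fun i => (t i).indicator fun s => g i s ^ 2)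
      fun i => ((hg i).pow_const 2).indicator (ht i)]
    refine Finset.prod_congr rfl fun i _ => ?_
    rw [integral_indicator (ht i), setIntegral_sq_eq_measureReal (hg i) (hPQ i) (ht i)]
  suffices h : ν.withDensity (fun x => ENNReal.ofReal (F x ^ 2)) = Measure.infinitePi P by
    rw [← h]; exact withDensity_absolutelyContinuous _ _
  refine Measure.eq_infinitePi P fun s t ht => ?_
  have htm : MeasurableSet (Set.pi (s : Set ℕ) t) :=
    MeasurableSet.pi (Set.to_countable _) fun i _ => ht i
  rw [withDensity_apply _ htm, ← ofReal_integral_eq_lintegral_ofReal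
    hFL.integrable_sq.integrableOn (ae_of_all _ fun _ => sq_nonneg _)]
  obtain ⟨N₀, hN₀⟩ := s.bddAbove
  set t' : ℕ → Set E := fun i => if i ∈ s then t i else Set.univ with ht'
  -- On a cylinder based on `s`, the integral of `f n ^ 2` is constant once `n` exceeds all indices
  -- in `s`.
  have hlim : Tendsto (fun n => ∫ x in Set.pi (s : Set ℕ) t, f n x ^ 2 ∂ν) atTop
      (𝓝 (∏ i ∈ s, (P i).real (t i))) := by
    refine tendsto_const_nhds.congr' ?_
    filter_upwards [eventually_gt_atTop N₀] with N hN
    have hsub : s ⊆ Finset.range N := fun i hi =>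
      Finset.mem_range.2 ((hN₀ (Finset.mem_coe.2 hi)).trans_lt hN)
    have hset : Set.pi (s : Set ℕ) t = Set.pi (Finset.range N : Set ℕ) t' := by
      ext x
      simp only [Set.mem_pi, Finset.mem_coe, ht']
      refine ⟨fun h i _ => ?_, fun h i hi => ?_⟩
      · by_cases hi : i ∈ s
        · simpa [hi] using h i hi
        · simp [hi]
      · simpa [hi] using h i (hsub hi)
    rw [hset, hbox N t' fun i => by
      by_cases hi : i ∈ s
      · simpa [ht', hi] using ht i
      · simp [ht', hi]]
    rw [← Finset.prod_subset hsub fun i _ hi => by simp [ht', hi]]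
    exact Finset.prod_congr rfl fun i hi => by simp [ht', hi]
  rw [tendsto_nhds_unique (hF _) hlim, ENNReal.ofReal_prod_of_nonneg fun i _ => measureReal_nonneg]
  exact Finset.prod_congr rfl fun i _ => ofReal_measureReal

/-! ### Centered isotropic Gaussian measures -/

section IsotropicGaussian

variable {E : Type*} [NormedAddCommGroup E] [InnerProductSpace ℝ E]

/-- The Lebesgue density of `isotropicGaussian E σ`. -/
noncomputable def isotropicGaussianDensity (E : Type*) [NormedAddCommGroup E]
    [InnerProductSpace ℝ E] (σ : ℝ) (t : E) : ℝ :=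
  (2 * Real.pi * σ ^ 2)⁻¹ ^ ((Module.finrank ℝ E : ℝ) / 2) *
    Real.exp (-(2 * σ ^ 2)⁻¹ * ‖t‖ ^ 2)

/-- The square root of the density of `isotropicGaussian E σ` with respect to
`isotropicGaussian E τ`. -/
noncomputable def sqrtGaussianRatio (E : Type*) [NormedAddCommGroup E] [InnerProductSpace ℝ E]
    (σ τ : ℝ) (t : E) : ℝ :=
  (τ / σ) ^ ((Module.finrank ℝ E : ℝ) / 2) *
    Real.exp (-((4 * σ ^ 2)⁻¹ - (4 * τ ^ 2)⁻¹) * ‖t‖ ^ 2)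

theorem isotropicGaussianDensity_pos {σ : ℝ} (hσ : 0 < σ) (t : E) :
    0 < isotropicGaussianDensity E σ t := by
  have := Real.pi_pos
  unfold isotropicGaussianDensity
  positivity

theorem isotropicGaussianDensity_mul_sq {σ τ : ℝ} (hσ : 0 < σ) (hτ : 0 < τ) (t : E) :
    isotropicGaussianDensity E τ t * sqrtGaussianRatio E σ τ t ^ 2
      = isotropicGaussianDensity E σ t := by
  have hpi := Real.pi_pos
  unfold isotropicGaussianDensity sqrtGaussianRatio
  rw [mul_pow, ← Real.exp_nat_mul, pow_two (_ ^ _), ← Real.mul_rpow (by positivity) (by positivity),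
    mul_mul_mul_comm, ← Real.mul_rpow (by positivity) (by positivity), ← Real.exp_add]
  congr 2
  · field_simp
  · push_cast
    field_simp
    ring

variable [MeasurableSpace E] [BorelSpace E]

theorem measurable_isotropicGaussianDensity (σ : ℝ) :
    Measurable (isotropicGaussianDensity E σ) := by
  unfold isotropicGaussianDensity
  fun_prop

theorem measurable_sqrtGaussianRatio (σ τ : ℝ) : Measurable (sqrtGaussianRatio E σ τ) := by
  unfold sqrtGaussianRatio
  fun_prop

variable [FiniteDimensional ℝ E]

/-- The centered Gaussian measure on `E` with covariance `σ² I`. -/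
noncomputable def isotropicGaussian (E : Type*) [NormedAddCommGroup E] [InnerProductSpace ℝ E]
    [FiniteDimensional ℝ E] [MeasurableSpace E] (σ : ℝ) : Measure E :=
  (stdGaussian E).map fun t : E => σ • t

instance isProbabilityMeasure_isotropicGaussian (σ : ℝ) :
    IsProbabilityMeasure (isotropicGaussian E σ) :=
  Measure.isProbabilityMeasure_map (by fun_prop)

theorem charFun_isotropicGaussian (σ : ℝ) (t : E) :
    charFun (isotropicGaussian E σ) t = Complex.exp (-(σ ^ 2 * ‖t‖ ^ 2) / 2) := by
  rw [isotropicGaussian, charFun_map_smul, charFun_stdGaussian, norm_smul, Complex.ofReal_mul,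
    mul_pow, Real.norm_eq_abs, ← Complex.ofReal_pow |σ|, sq_abs, Complex.ofReal_pow]

theorem integrable_exp_neg_mul_norm_sq {b : ℝ} (hb : 0 < b) :
    Integrable fun t : E => Real.exp (-b * ‖t‖ ^ 2) := by
  refine Integrable.of_integral_ne_zero ?_
  rw [GaussianFourier.integral_rexp_neg_mul_sq_norm hb]
  have := Real.pi_pos
  positivity

theorem integrable_isotropicGaussianDensity {σ : ℝ} (hσ : 0 < σ) :
    Integrable (isotropicGaussianDensity E σ) :=
  (integrable_exp_neg_mul_norm_sq (by positivity)).const_mul _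

/-- The two finite measures have the same characteristic function, by the Gaussian Fourier integral.
-/
theorem isotropicGaussian_eq_withDensity {σ : ℝ} (hσ : 0 < σ) :
    isotropicGaussian E σ
      = volume.withDensity fun t => ENNReal.ofReal (isotropicGaussianDensity E σ t) := by
  have hpi := Real.pi_pos
  have : IsFiniteMeasure
      ((volume : Measure E).withDensity fun t => ENNReal.ofReal (isotropicGaussianDensity E σ t)) :=
    isFiniteMeasure_withDensity_ofReal (integrable_isotropicGaussianDensity hσ).2
  refine Measure.ext_of_charFun ?_
  ext t
  rw [charFun_isotropicGaussian, charFun_apply, integral_withDensity_eq_integral_toReal_smul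
    (measurable_isotropicGaussianDensity σ).ennreal_ofReal
    (ae_of_all _ fun _ => ENNReal.ofReal_lt_top)]
  set b : ℝ := (2 * σ ^ 2)⁻¹ with hb
  have hb0 : 0 < b := by positivity
  have e : ∀ x : E, (ENNReal.ofReal (isotropicGaussianDensity E σ x)).toReal •
      Complex.exp (inner ℝ x t * Complex.I)
      = ((2 * Real.pi * σ ^ 2)⁻¹ ^ ((Module.finrank ℝ E : ℝ) / 2) : ℝ) *
        Complex.exp (-(b : ℂ) * ‖x‖ ^ 2 + Complex.I * inner ℝ t x) := fun x => by
    rw [ENNReal.toReal_ofReal (isotropicGaussianDensity_pos hσ x).le, isotropicGaussianDensity,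
      Complex.real_smul, Complex.ofReal_mul, mul_assoc, Complex.ofReal_exp, ← Complex.exp_add,
      real_inner_comm]
    rw [mul_comm Complex.I, Complex.ofReal_mul, Complex.ofReal_neg, Complex.ofReal_pow]
  simp only [e]
  rw [integral_const_mul, GaussianFourier.integral_cexp_neg_mul_sq_norm_add (by simpa using hb0),
    ← mul_assoc]
  have h1 : ((Real.pi : ℂ) / b) ^ ((Module.finrank ℝ E : ℂ) / 2)
      = ((Real.pi / b) ^ ((Module.finrank ℝ E : ℝ) / 2) : ℝ) := by
    rw [Complex.ofReal_cpow (by positivity)]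
    push_cast
    rfl
  rw [h1, ← Complex.ofReal_mul, ← Real.mul_rpow (by positivity) (by positivity)]
  have h2 : (2 * Real.pi * σ ^ 2)⁻¹ * (Real.pi / b) = 1 := by
    rw [hb]; field_simp
  rw [h2, Real.one_rpow, Complex.ofReal_one, one_mul, Complex.I_sq, hb]
  congr 1
  have : (σ : ℂ) ≠ 0 := by exact_mod_cast hσ.ne'
  push_cast
  field_simp
  norm_num

theorem isotropicGaussian_absolutelyContinuous {σ : ℝ} (hσ : 0 < σ) :
    isotropicGaussian E σ ≪ volume := by
  rw [isotropicGaussian_eq_withDensity hσ]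
  exact withDensity_absolutelyContinuous _ _

theorem isotropicGaussian_eq_withDensity_sq {σ τ : ℝ} (hσ : 0 < σ) (hτ : 0 < τ) :
    isotropicGaussian E σ = (isotropicGaussian E τ).withDensity
      fun t => ENNReal.ofReal (sqrtGaussianRatio E σ τ t ^ 2) := by
  rw [isotropicGaussian_eq_withDensity hσ, isotropicGaussian_eq_withDensity hτ,
    ← withDensity_mul _ (measurable_isotropicGaussianDensity τ).ennreal_ofReal
      ((measurable_sqrtGaussianRatio σ τ).pow_const 2).ennreal_ofReal]
  congr 1 with t
  rw [Pi.mul_apply, ← ENNReal.ofReal_mul (isotropicGaussianDensity_pos hτ t).le,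
    isotropicGaussianDensity_mul_sq hσ hτ]

theorem integral_sqrtGaussianRatio {σ τ : ℝ} (hσ : 0 < σ) (hτ : 0 < τ) :
    ∫ t, sqrtGaussianRatio E σ τ t ∂isotropicGaussian E τ
      = (2 * σ * τ / (σ ^ 2 + τ ^ 2)) ^ ((Module.finrank ℝ E : ℝ) / 2) := by
  have hpi := Real.pi_pos
  rw [isotropicGaussian_eq_withDensity hτ, integral_withDensity_eq_integral_toReal_smul
    (measurable_isotropicGaussianDensity τ).ennreal_ofReal
    (ae_of_all _ fun _ => ENNReal.ofReal_lt_top)]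
  set b : ℝ := (4 * σ ^ 2)⁻¹ + (4 * τ ^ 2)⁻¹ with hb
  have hb0 : 0 < b := by positivity
  have e : ∀ x : E, (ENNReal.ofReal (isotropicGaussianDensity E τ x)).toReal •
      sqrtGaussianRatio E σ τ x
      = ((2 * Real.pi * τ ^ 2)⁻¹ * (τ / σ)) ^ ((Module.finrank ℝ E : ℝ) / 2) *
        Real.exp (-b * ‖x‖ ^ 2) := fun x => by
    rw [ENNReal.toReal_ofReal (isotropicGaussianDensity_pos hτ x).le, isotropicGaussianDensity,
      sqrtGaussianRatio, smul_eq_mul, mul_mul_mul_comm,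
      ← Real.mul_rpow (by positivity) (by positivity), ← Real.exp_add]
    congr 2
    rw [hb]
    field_simp
    ring
  simp only [e]
  rw [integral_const_mul, GaussianFourier.integral_rexp_neg_mul_sq_norm hb0,
    ← Real.mul_rpow (by positivity) (by positivity)]
  congr 1
  rw [hb]
  field_simp
  ring

theorem one_sub_integral_sqrtGaussianRatio_le {σ τ : ℝ} (hσ : 0 < σ) (hτ : 0 < τ) :
    1 - ∫ t, sqrtGaussianRatio E σ τ t ∂isotropicGaussian E τ
      ≤ Module.finrank ℝ E * ((σ - τ) ^ 2 / (σ ^ 2 + τ ^ 2)) := by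
  rw [integral_sqrtGaussianRatio hσ hτ]
  set z := 2 * σ * τ / (σ ^ 2 + τ ^ 2) with hz
  have hz0 : 0 < z := by positivity
  have hz1 : (σ - τ) ^ 2 / (σ ^ 2 + τ ^ 2) = 1 - z := by rw [hz]; field_simp; ring
  have hle : z ≤ 1 := by
    have : 0 ≤ (σ - τ) ^ 2 / (σ ^ 2 + τ ^ 2) := by positivity
    linarith
  -- Since `z ≤ 1`, the exponent may be doubled; it becomes an integer, to which Bernoulli's
  -- inequality applies.
  have h1 : z ^ Module.finrank ℝ E ≤ z ^ ((Module.finrank ℝ E : ℝ) / 2) := by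
    rw [← Real.rpow_natCast]
    exact Real.rpow_le_rpow_of_exponent_ge hz0 hle (half_le_self (Nat.cast_nonneg _))
  have h2 := one_add_mul_le_pow (a := z - 1) (by linarith) (Module.finrank ℝ E)
  rw [add_sub_cancel] at h2
  rw [hz1]
  linarith

theorem infinitePi_isotropicGaussian_absolutelyContinuous {σ τ : ℕ → ℝ} (hσ : ∀ n, 0 < σ n)
    (hτ : ∀ n, 0 < τ n)
    (h : Summable fun n => (σ n - τ n) ^ 2 / (σ n ^ 2 + τ n ^ 2)) :
    Measure.infinitePi (fun n => isotropicGaussian E (σ n))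
      ≪ Measure.infinitePi fun n => isotropicGaussian E (τ n) := by
  refine infinitePi_absolutelyContinuous _ _ (fun n => measurable_sqrtGaussianRatio (σ n) (τ n))
    (fun n t => ?_) (fun n => isotropicGaussian_eq_withDensity_sq (hσ n) (hτ n)) ?_
  · have := hσ n
    have := hτ n
    unfold sqrtGaussianRatio
    positivity
  · refine Summable.of_nonneg_of_le (fun n => ?_)
      (fun n => one_sub_integral_sqrtGaussianRatio_le (hσ n) (hτ n)) (h.mul_left _)
    rw [integral_sqrtGaussianRatio (hσ n) (hτ n), sub_nonneg]
    have := hσ n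
    have := hτ n
    refine Real.rpow_le_one (by positivity) ?_ (by positivity)
    rw [div_le_one (by positivity)]
    nlinarith [sq_nonneg (σ n - τ n)]

/-- Apply `log y ≤ 4 y^(1/4)` to `y` and `y⁻¹`. The negative exponent stays above `-1`, so the bound
is integrable at `0` even in dimension one. -/
theorem sq_log_le {y : ℝ} (hy : 0 < y) :
    Real.log y ^ 2 ≤ 32 * (y ^ (1 / 2 : ℝ) + y ^ (-(1 / 2) : ℝ)) := by
  have h1 := Real.log_le_rpow_div hy.le (ε := 1 / 4) (by norm_num)
  have h2 := Real.log_le_rpow_div (inv_pos.2 hy).le (ε := 1 / 4) (by norm_num)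
  rw [Real.log_inv, Real.inv_rpow hy.le, ← Real.rpow_neg hy.le] at h2
  set a := y ^ (1 / 4 : ℝ) with ha
  set b := y ^ (-(1 / 4) : ℝ) with hb
  have ha0 : 0 < a := Real.rpow_pos_of_pos hy _
  have hb0 : 0 < b := Real.rpow_pos_of_pos hy _
  have ha2 : y ^ (1 / 2 : ℝ) = a ^ 2 := by
    rw [ha, ← Real.rpow_natCast, ← Real.rpow_mul hy.le]; norm_num
  have hb2 : y ^ (-(1 / 2) : ℝ) = b ^ 2 := by
    rw [hb, ← Real.rpow_natCast, ← Real.rpow_mul hy.le]; norm_num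
  rw [ha2, hb2]
  have h3 : |Real.log y| ≤ 4 * (a + b) := abs_le.2 ⟨by linarith, by linarith⟩
  calc Real.log y ^ 2 = |Real.log y| ^ 2 := (sq_abs _).symm
    _ ≤ (4 * (a + b)) ^ 2 := by gcongr
    _ ≤ 32 * (a ^ 2 + b ^ 2) := by nlinarith [sq_nonneg (a - b)]

theorem memLp_log_norm_isotropicGaussian [Nontrivial E] {σ : ℝ} (hσ : 0 < σ) :
    MemLp (fun t : E => Real.log ‖t‖) 2 (isotropicGaussian E σ) := by
  have hm : Measurable fun t : E => Real.log ‖t‖ := by fun_prop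
  rw [memLp_two_iff_integrable_sq hm.aestronglyMeasurable, isotropicGaussian_eq_withDensity hσ,
    integrable_withDensity_iff (measurable_isotropicGaussianDensity σ).ennreal_ofReal
      (ae_of_all _ fun _ => ENNReal.ofReal_lt_top)]
  set b : ℝ := (2 * σ ^ 2)⁻¹ with hb
  have hb0 : 0 < b := by positivity
  set C : ℝ := (2 * Real.pi * σ ^ 2)⁻¹ ^ ((Module.finrank ℝ E : ℝ) / 2)
  suffices h : Integrable fun t : E => Real.log ‖t‖ ^ 2 * Real.exp (-b * ‖t‖ ^ 2) by
    refine (h.const_mul C).congr (ae_of_all _ fun t => ?_)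
    beta_reduce
    rw [ENNReal.toReal_ofReal (isotropicGaussianDensity_pos hσ t).le, isotropicGaussianDensity]
    ring
  rw [integrable_fun_norm_addHaar volume
    (f := fun y : ℝ => Real.log y ^ 2 * Real.exp (-b * y ^ 2))]
  set k := Module.finrank ℝ E - 1
  have hk : (0 : ℝ) ≤ k := Nat.cast_nonneg k
  have hint := ((integrableOn_rpow_mul_exp_neg_mul_sq hb0 (s := k + 1 / 2) (by linarith)).add
    (integrableOn_rpow_mul_exp_neg_mul_sq hb0 (s := k - 1 / 2) (by linarith))).const_mul 32
  refine Integrable.mono' hint (by fun_prop) ?_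
  refine (ae_restrict_iff' measurableSet_Ioi).2 (ae_of_all _ fun y hy => ?_)
  have hy0 : 0 < y := hy
  rw [Real.norm_of_nonneg (by positivity), smul_eq_mul, Pi.add_apply, Real.rpow_add hy0,
    sub_eq_add_neg, Real.rpow_add hy0, Real.rpow_natCast]
  have := mul_le_mul_of_nonneg_right (mul_le_mul_of_nonneg_left (sq_log_le hy0)
    (pow_nonneg hy0.le k)) (Real.exp_pos (-b * y ^ 2)).le
  linarith

theorem lintegral_enorm_rpow_isotropicGaussian (σ : ℝ) {q : ℝ} (hq : 0 ≤ q) :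
    ∫⁻ t, ‖t‖ₑ ^ q ∂isotropicGaussian E σ = ‖σ‖ₑ ^ q * ∫⁻ t, ‖t‖ₑ ^ q ∂stdGaussian E := by
  rw [isotropicGaussian, lintegral_map (by fun_prop) (by fun_prop),
    ← lintegral_const_mul _ (by fun_prop)]
  congr 1 with t
  rw [enorm_smul, ENNReal.mul_rpow_of_nonneg _ _ hq]

theorem lintegral_enorm_rpow_stdGaussian_ne_top {p : ℝ≥0∞} (h0 : p ≠ 0) (hp : p ≠ ∞) :
    ∫⁻ t, ‖t‖ₑ ^ p.toReal ∂stdGaussian E ≠ ∞ :=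
  (lintegral_rpow_enorm_lt_top_of_eLpNorm_lt_top h0 hp
    (IsGaussian.memLp_id (stdGaussian E) p hp).2).ne

end IsotropicGaussian

/-- Rotation invariance: on the Fourier side, multiplication by `c` becomes multiplication by its
conjugate, and only the norm of the frequency matters. -/
theorem isotropicGaussian_map_mul {𝕜 : Type*} [RCLike 𝕜] (c : 𝕜) (σ : ℝ) :
    (isotropicGaussian 𝕜 σ).map (fun t => c * t) = isotropicGaussian 𝕜 (‖c‖ * σ) := by
  have : IsProbabilityMeasure ((isotropicGaussian 𝕜 σ).map fun t => c * t) :=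
    Measure.isProbabilityMeasure_map (by fun_prop)
  refine Measure.ext_of_charFun ?_
  ext t
  have h1 : charFun ((isotropicGaussian 𝕜 σ).map fun t => c * t) t
      = charFun (isotropicGaussian 𝕜 σ) ((starRingEnd 𝕜) c * t) := by
    rw [charFun_apply, charFun_apply, integral_map (by fun_prop) (by fun_prop)]
    congr 1 with x
    have : inner ℝ (c * x) t = inner ℝ x ((starRingEnd 𝕜) c * t) := by
      rw [real_inner_eq_re_inner 𝕜, real_inner_eq_re_inner 𝕜, RCLike.inner_apply,
        RCLike.inner_apply, map_mul (starRingEnd 𝕜)]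
      congr 1
      ring
    rw [this]
  rw [h1, charFun_isotropicGaussian, charFun_isotropicGaussian, norm_mul, RCLike.norm_conj]
  congr 1
  push_cast
  ring

/-! ### Measures on `ℓ_p` and measures on the product space -/

theorem ellpIncl_injective {𝕜 : Type*} [RCLike 𝕜] {p : ℝ≥0∞} :
    Function.Injective (ellpIncl 𝕜 p) := fun _ _ h => lp.ext h

section Embedding

variable {𝕜 : Type*} [RCLike 𝕜] {p : ℝ≥0∞} [Fact (1 ≤ p)]

/-- Finitely supported sequences are dense as `p < ∞`. Separability makes `ℓ_p` Polish, so that the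
Lusin–Souslin theorem turns the injective inclusion into a measurable embedding. -/
theorem separableSpace_ellp (hp : p ≠ ∞) : TopologicalSpace.SeparableSpace (Ellp 𝕜 p) := by
  rw [← TopologicalSpace.isSeparable_univ_iff]
  have hs : TopologicalSpace.IsSeparable
      (Submodule.span 𝕜 (Set.range fun i : ℕ => (lp.single p i (1 : 𝕜) : Ellp 𝕜 p)) :
        Set (Ellp 𝕜 p)) :=
    (Set.countable_range _).isSeparable.span
  refine hs.closure.mono fun x _ => ?_
  refine mem_closure_of_tendsto (lp.hasSum_single hp x) (Eventually.of_forall fun s => ?_)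
  refine Submodule.sum_mem _ fun i _ => ?_
  have : (lp.single p i (x i) : Ellp 𝕜 p) = x i • lp.single p i (1 : 𝕜) := by
    rw [← lp.single_smul, smul_eq_mul, mul_one]
  rw [this]
  exact Submodule.smul_mem _ _ (Submodule.subset_span ⟨i, rfl⟩)

theorem measurableEmbedding_ellpIncl (hp : p ≠ ∞) : MeasurableEmbedding (ellpIncl 𝕜 p) := by
  have := separableSpace_ellp (𝕜 := 𝕜) hp
  exact (measurable_ellpIncl 𝕜 p).measurableEmbedding ellpIncl_injective

/-- The weighted backward shift on the space of all sequences. -/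
def seqShift (w : ℕ → 𝕜) (x : ℕ → 𝕜) : ℕ → 𝕜 := fun n => w (n + 1) * x (n + 1)

theorem measurable_seqShift (w : ℕ → 𝕜) : Measurable (seqShift w) :=
  measurable_pi_lambda _ fun n => (measurable_pi_apply (n + 1)).const_mul _

theorem map_seqShift_infinitePi (w : ℕ → 𝕜) (μ : ℕ → Measure 𝕜)
    [∀ n, IsProbabilityMeasure (μ n)] :
    (Measure.infinitePi μ).map (seqShift w)
      = Measure.infinitePi fun n => (μ (n + 1)).map fun t => w (n + 1) * t := by
  rw [← Measure.infinitePi_map_pi (fun n => μ (n + 1)) fun n => measurable_const_mul (w (n + 1)),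
    ← Measure.map_infinitePi_infinitePi_of_inj (add_left_injective 1),
    Measure.map_map (by fun_prop) (by fun_prop)]
  rfl

theorem map_weightedShift_map_ellpIncl (w : ℕ → 𝕜) (hw : IsWeightSequence w)
    (m : Measure (Ellp 𝕜 p)) :
    (m.map (weightedShift p w hw)).map (ellpIncl 𝕜 p)
      = (m.map (ellpIncl 𝕜 p)).map (seqShift w) := by
  rw [Measure.map_map (measurable_ellpIncl 𝕜 p) (weightedShift p w hw).continuous.measurable,
    Measure.map_map (measurable_seqShift w) (measurable_ellpIncl 𝕜 p)]
  rfl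

theorem weightProd_succ (w : ℕ → 𝕜) (n : ℕ) :
    weightProd w (n + 1) = weightProd w n * w (n + 1) :=
  Finset.prod_Icc_succ_top (by omega) _

theorem weightProd_ne_zero {w : ℕ → 𝕜} (hw : IsWeightSequence w) (n : ℕ) : weightProd w n ≠ 0 :=
  Finset.prod_ne_zero_iff.2 fun k hk => hw.ne_zero k (Finset.mem_Icc.1 hk).1

/-- The marginals of an invariant product measure are determined by the first one. -/
theorem map_weightProd_mul_marginal {w : ℕ → 𝕜} {hw : IsWeightSequence w}
    {m : Measure (Ellp 𝕜 p)} (hm : MeasurePreserving (weightedShift p w hw) m m)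
    {μ : ℕ → Measure 𝕜} [∀ n, IsProbabilityMeasure (μ n)]
    (hμ : m.map (ellpIncl 𝕜 p) = Measure.infinitePi μ) (n : ℕ) :
    (μ n).map (fun t => weightProd w n * t) = μ 0 := by
  have h := map_weightedShift_map_ellpIncl w hw m
  rw [hm.map_eq, hμ, map_seqShift_infinitePi] at h
  have : ∀ n, IsProbabilityMeasure ((μ (n + 1)).map fun t => w (n + 1) * t) := fun n =>
    Measure.isProbabilityMeasure_map (by fun_prop)
  have hstep : ∀ n, (μ (n + 1)).map (fun t => w (n + 1) * t) = μ n := fun n => by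
    rw [← Measure.infinitePi_map_eval μ n, h, Measure.infinitePi_map_eval]
  induction n with
  | zero => simp [weightProd]
  | succ n ih =>
    rw [← ih, ← hstep n, Measure.map_map (by fun_prop) (by fun_prop)]
    congr 1 with t
    rw [weightProd_succ, Function.comp_apply, mul_assoc]

/-- The inclusion is a measurable embedding intertwining the shifts, so invariance can be checked on
the sequence space, one marginal at a time. -/
theorem exists_invariant_of_marginals (hp : p ≠ ∞) {w : ℕ → 𝕜} (hw : IsWeightSequence w)
    {μ : ℕ → Measure 𝕜} [∀ n, IsProbabilityMeasure (μ n)]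
    (hstep : ∀ n, (μ (n + 1)).map (fun t => w (n + 1) * t) = μ n)
    (hae : ∀ᵐ x ∂Measure.infinitePi μ, x ∈ Set.range (ellpIncl 𝕜 p)) :
    IsProbabilityMeasure ((Measure.infinitePi μ).comap (ellpIncl 𝕜 p)) ∧
    MeasurePreserving (weightedShift p w hw) ((Measure.infinitePi μ).comap (ellpIncl 𝕜 p))
      ((Measure.infinitePi μ).comap (ellpIncl 𝕜 p)) ∧
    ((Measure.infinitePi μ).comap (ellpIncl 𝕜 p)).map (ellpIncl 𝕜 p) = Measure.infinitePi μ := by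
  have he := measurableEmbedding_ellpIncl (𝕜 := 𝕜) hp
  have hmap : ((Measure.infinitePi μ).comap (ellpIncl 𝕜 p)).map (ellpIncl 𝕜 p)
      = Measure.infinitePi μ := by
    rw [he.map_comap, Measure.restrict_eq_self_of_ae_mem hae]
  set m := (Measure.infinitePi μ).comap (ellpIncl 𝕜 p) with hm
  have hcomap : ∀ ν : Measure (Ellp 𝕜 p), (ν.map (ellpIncl 𝕜 p)).comap (ellpIncl 𝕜 p) = ν :=
    fun ν => he.comap_map ν
  refine ⟨?_, ⟨(weightedShift p w hw).continuous.measurable, ?_⟩, hmap⟩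
  · have : IsProbabilityMeasure (m.map (ellpIncl 𝕜 p)) := by rw [hmap]; infer_instance
    exact Measure.isProbabilityMeasure_of_map (ellpIncl 𝕜 p)
  · rw [← hcomap (m.map (weightedShift p w hw)), map_weightedShift_map_ellpIncl, hmap,
      map_seqShift_infinitePi]
    simp only [hstep]
    exact hm.symm

/-- By scaling, the expectation of `∑ |x_n|^p` is a finite moment times `∑ |σ_n|^p`; hence the sum
is almost surely finite. -/
theorem ae_mem_range_ellpIncl_isotropicGaussian (hp : p ≠ ∞) {σ : ℕ → ℝ}
    (hσ : Summable fun n => ‖σ n‖ ^ p.toReal) :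
    ∀ᵐ x ∂Measure.infinitePi (fun n => isotropicGaussian 𝕜 (σ n)),
      x ∈ Set.range (ellpIncl 𝕜 p) := by
  have hp1 : 1 ≤ p := Fact.out
  have hp0 : p ≠ 0 := (zero_lt_one.trans_le hp1).ne'
  have hpos : 0 < p.toReal := ENNReal.toReal_pos hp0 hp
  have hmeas : ∀ n, Measurable fun x : ℕ → 𝕜 => ‖x n‖ₑ ^ p.toReal := fun n => by fun_prop
  have hlin : ∫⁻ x, ∑' n, ‖x n‖ₑ ^ p.toReal
      ∂Measure.infinitePi (fun n => isotropicGaussian 𝕜 (σ n)) ≠ ∞ := by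
    rw [lintegral_tsum fun n => (hmeas n).aemeasurable]
    have e : ∀ n, ∫⁻ x : ℕ → 𝕜, ‖x n‖ₑ ^ p.toReal
        ∂Measure.infinitePi (fun n => isotropicGaussian 𝕜 (σ n))
        = ENNReal.ofReal (‖σ n‖ ^ p.toReal) * ∫⁻ t, ‖t‖ₑ ^ p.toReal ∂stdGaussian 𝕜 := fun n => by
      rw [← ENNReal.ofReal_rpow_of_nonneg (norm_nonneg _) hpos.le, ofReal_norm,
        ← lintegral_enorm_rpow_isotropicGaussian _ hpos.le,
        ← Measure.infinitePi_map_eval (fun n => isotropicGaussian 𝕜 (σ n)) n,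
        lintegral_map (f := fun t : 𝕜 => ‖t‖ₑ ^ p.toReal) (by fun_prop) (by fun_prop)]
    simp only [e]
    rw [ENNReal.tsum_mul_right]
    exact ENNReal.mul_ne_top hσ.tsum_ofReal_ne_top
      (lintegral_enorm_rpow_stdGaussian_ne_top hp0 hp)
  filter_upwards [ae_lt_top (Measurable.tsum hmeas) hlin] with x hx
  have hx' : Memℓp x p := by
    refine memℓp_gen ((ENNReal.summable_toReal hx.ne).congr fun n => ?_)
    rw [← ENNReal.toReal_rpow, toReal_enorm]
  exact ⟨⟨x, hx'⟩, rfl⟩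

end Embedding

/-! ### Summability of the inverse products of the weights -/

/-- From `exp (-s) * (s + 1) ≤ 1` one gets `1 - exp (-s) ≥ s * exp (-s)`, which is at least `s / 2`
as soon as `exp (-s) > 1 / 2`. -/
theorem summable_of_summable_one_sub_exp_neg {s : ℕ → ℝ} (hs : ∀ n, 0 ≤ s n)
    (h : Summable fun n => 1 - Real.exp (-s n)) : Summable s := by
  have hlim : ∀ᶠ n in atTop, 1 - Real.exp (-s n) < 1 / 2 :=
    h.tendsto_atTop_zero.eventually (gt_mem_nhds (by norm_num))
  refine Summable.of_norm_bounded_eventually_nat (h.mul_left 2) ?_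
  filter_upwards [hlim] with n hn
  rw [Real.norm_of_nonneg (hs n)]
  have h1 := Real.add_one_le_exp (s n)
  have h2 : Real.exp (-s n) * Real.exp (s n) = 1 := by rw [← Real.exp_add]; simp
  have h3 := Real.exp_pos (-s n)
  have h4 : Real.exp (-s n) * (s n + 1) ≤ 1 := by nlinarith
  nlinarith [hs n]

theorem exists_pos_measure_norm_gt {𝕜 : Type*} [RCLike 𝕜] {μ : Measure 𝕜}
    [IsProbabilityMeasure μ] (h0 : μ {0} = 0) :
    ∃ ε : ℝ, 0 < ε ∧ 0 < μ.real {t | ε < ‖t‖} := by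
  by_contra! hcon
  have hz : ∀ n : ℕ, μ {t : 𝕜 | 1 / ((n : ℝ) + 1) < ‖t‖} = 0 := fun n => by
    have := (hcon _ (Nat.one_div_pos_of_nat (n := n))).antisymm measureReal_nonneg
    simpa [measureReal_def, ENNReal.toReal_eq_zero_iff] using this
  have hu : (Set.univ : Set 𝕜) ⊆ {0} ∪ ⋃ n : ℕ, {t : 𝕜 | 1 / ((n : ℝ) + 1) < ‖t‖} := by
    intro t _
    by_cases ht : t = 0
    · exact Or.inl ht
    · obtain ⟨n, hn⟩ := exists_nat_one_div_lt (norm_pos_iff.2 ht)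
      exact Or.inr (Set.mem_iUnion.2 ⟨n, hn⟩)
  have := measure_mono_null hu (measure_union_null h0 (measure_iUnion_null hz))
  simp at this

/-- If a weighted shift has an invariant product measure whose first marginal does not charge `0`,
then the inverse products of the weights are `p`-summable. -/
theorem invProdSummable_of_invariant {𝕜 : Type*} [RCLike 𝕜] {p : ℝ≥0∞} [Fact (1 ≤ p)]
    (hp : p ≠ ∞) {w : ℕ → 𝕜} {hw : IsWeightSequence w} {m : Measure (Ellp 𝕜 p)}
    [IsProbabilityMeasure m] (hm : MeasurePreserving (weightedShift p w hw) m m)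
    {μ : ℕ → Measure 𝕜} [∀ n, IsProbabilityMeasure (μ n)]
    (hμ : m.map (ellpIncl 𝕜 p) = Measure.infinitePi μ) (h0 : μ 0 {0} = 0) :
    InvProdSummable p w := by
  have hp1 : 1 ≤ p := Fact.out
  have hpos : 0 < p.toReal := ENNReal.toReal_pos (zero_lt_one.trans_le hp1).ne' hp
  set q := p.toReal with hq
  set f : 𝕜 → ℝ := fun t => Real.exp (-‖t‖ ^ q) with hf
  have hfm : Measurable f := by fun_prop
  have hf0 : ∀ t, 0 < f t := fun t => Real.exp_pos _
  have hf1 : ∀ t, f t ≤ 1 := fun t => Real.exp_le_one_iff.2 (by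
    have : 0 ≤ ‖t‖ ^ q := by positivity
    linarith)
  have hfi : ∀ n, Integrable f (μ n) := fun n =>
    Integrable.of_mem_Icc 0 1 hfm.aemeasurable (ae_of_all _ fun t => ⟨(hf0 t).le, hf1 t⟩)
  have ha0 : ∀ n, 0 ≤ 1 - ∫ t, f t ∂μ n := fun n => by
    rw [sub_nonneg]
    calc ∫ t, f t ∂μ n ≤ ∫ _, (1 : ℝ) ∂μ n :=
          integral_mono (hfi n) (integrable_const _) hf1
      _ = 1 := by simp
  have hgm : Measurable fun x : Ellp 𝕜 p => Real.exp (-‖x‖ ^ q) :=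
    (Real.continuous_exp.comp ((Real.continuous_rpow_const hpos.le).comp
      continuous_norm).neg).measurable
  have hgi : Integrable (fun x : Ellp 𝕜 p => Real.exp (-‖x‖ ^ q)) m :=
    Integrable.of_mem_Icc 0 1 hgm.aemeasurable (ae_of_all _ fun x => ⟨(Real.exp_pos _).le,
      Real.exp_le_one_iff.2 (by
        have : 0 ≤ ‖x‖ ^ q := by positivity
        linarith)⟩)
  -- Because the norm is finite on `ℓ_p`, this integral is positive. It bounds all partial products
  -- of `∫ f ∂μ i` from below, whence `∑ (1 - ∫ f ∂μ i) ≤ -log c`.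
  set c := ∫ x, Real.exp (-‖x‖ ^ q) ∂m with hc
  have hc0 : 0 < c := integral_exp_pos hgi
  have hprod : ∀ N, c ≤ ∏ i ∈ Finset.range N, ∫ t, f t ∂μ i := fun N => by
    have hPm : Measurable fun x : ℕ → 𝕜 => ∏ i ∈ Finset.range N, f (x i) :=
      Finset.measurable_prod _ fun i _ => hfm.comp (measurable_pi_apply i)
    rw [← integral_infinitePi_finset_prod μ (f := fun _ => f) (fun _ => hfm), ← hμ,
      integral_map (measurable_ellpIncl 𝕜 p).aemeasurable hPm.aestronglyMeasurable]
    have hle : ∀ x : Ellp 𝕜 p, Real.exp (-‖x‖ ^ q)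
        ≤ ∏ i ∈ Finset.range N, f (ellpIncl 𝕜 p x i) := fun x => by
      simp only [hf]
      rw [← Real.exp_sum, Finset.sum_neg_distrib]
      exact Real.exp_le_exp.2 (neg_le_neg (lp.sum_rpow_le_norm_rpow hpos x _))
    refine integral_mono hgi (Integrable.of_mem_Icc 0 1 ?_ (ae_of_all _ fun x => ⟨?_, ?_⟩)) hle
    · exact (hPm.comp (measurable_ellpIncl 𝕜 p)).aemeasurable
    · exact Finset.prod_nonneg fun i _ => (hf0 _).le
    · exact Finset.prod_le_one (fun i _ => (hf0 _).le) fun i _ => hf1 _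
  have hsum : Summable fun n => 1 - ∫ t, f t ∂μ n := by
    refine summable_of_sum_range_le (c := -Real.log c) ha0 fun N => ?_
    rw [le_neg, Real.log_le_iff_le_exp hc0, ← Finset.sum_neg_distrib, Real.exp_sum]
    refine (hprod N).trans (Finset.prod_le_prod (fun i _ => integral_nonneg fun t => (hf0 t).le)
      fun i _ => ?_)
    have := Real.add_one_le_exp (-(1 - ∫ t, f t ∂μ i))
    linarith
  obtain ⟨ε, hε, hδ⟩ := exists_pos_measure_norm_gt h0
  set δ := (μ 0).real {t | ε < ‖t‖} with hδdef
  have hW : ∀ n, 0 < ‖weightProd w n‖ := fun n => norm_pos_iff.2 (weightProd_ne_zero hw n)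
  -- By rigidity, `|w_1 ⋯ w_n t| > ε` has the same probability `δ` under every `μ n`; there `|t|`
  -- exceeds `ε / |w_1 ⋯ w_n|`.
  have hlow : ∀ n, δ * (1 - Real.exp (-(ε ^ q * (1 / ‖weightProd w n‖ ^ q))))
      ≤ 1 - ∫ t, f t ∂μ n := fun n => by
    have hms : MeasurableSet {t : 𝕜 | ε < ‖weightProd w n * t‖} :=
      measurableSet_lt (by fun_prop) (by fun_prop)
    have hδn : δ = (μ n).real {t | ε < ‖weightProd w n * t‖} := by
      rw [hδdef, ← map_weightProd_mul_marginal hm hμ n, map_measureReal_apply (by fun_prop)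
        (measurableSet_lt (by fun_prop) (by fun_prop))]
      rfl
    have h1 : 1 - ∫ t, f t ∂μ n = ∫ t, (1 - f t) ∂μ n := by
      rw [integral_sub (integrable_const _) (hfi n)]; simp
    rw [h1, hδn, ← smul_eq_mul, ← setIntegral_const]
    refine (setIntegral_mono_on (integrable_const _).integrableOn
      ((integrable_const _).sub (hfi n)).integrableOn hms fun t ht => ?_).trans
      (setIntegral_le_integral ((integrable_const _).sub (hfi n))
        (ae_of_all _ fun t => sub_nonneg.2 (hf1 t)))
    simp only [hf]
    refine sub_le_sub_left (Real.exp_le_exp.2 (neg_le_neg ?_)) _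
    have ht' : ε < ‖weightProd w n‖ * ‖t‖ := by simpa using ht
    rw [mul_one_div, ← Real.div_rpow hε.le (hW n).le]
    refine Real.rpow_le_rpow (by have := hW n; positivity) ?_ hpos.le
    rw [div_le_iff₀ (hW n), mul_comm]
    exact ht'.le
  have hs0 : ∀ n, 0 ≤ ε ^ q * (1 / ‖weightProd w n‖ ^ q) := fun n => by positivity
  have h2 : Summable fun n => 1 - Real.exp (-(ε ^ q * (1 / ‖weightProd w n‖ ^ q))) := by
    refine Summable.of_nonneg_of_le (fun n => ?_) (fun n => ?_) (hsum.mul_left δ⁻¹)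
    · exact sub_nonneg.2 (Real.exp_le_one_iff.2 (neg_nonpos.2 (hs0 n)))
    · rw [inv_mul_eq_div, le_div_iff₀ hδ, mul_comm]
      exact hlow n
  have h3 := summable_of_summable_one_sub_exp_neg hs0 h2
  rw [summable_mul_left_iff (Real.rpow_pos_of_pos hε q).ne'] at h3
  exact (summable_nat_add_iff 1).2 h3

/-! ### Translates of real probability measures which are square summably close -/

theorem eventually_lt_measureReal_Icc (l : Measure ℝ) [IsProbabilityMeasure l] {c : ℝ}
    (hc : c < 1) : ∀ᶠ n : ℕ in atTop, c < l.real (Set.Icc (-n : ℝ) n) := by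
  have hmono : Monotone fun n : ℕ => Set.Icc (-n : ℝ) n := fun a b hab =>
    Set.Icc_subset_Icc (by simpa using hab) (by simpa using hab)
  have hU : ⋃ n : ℕ, Set.Icc (-n : ℝ) n = Set.univ := by
    refine Set.eq_univ_of_forall fun x => ?_
    obtain ⟨n, hn⟩ := exists_nat_ge |x|
    exact Set.mem_iUnion.2 ⟨n, abs_le.1 hn⟩
  have h := tendsto_measure_iUnion_atTop (μ := l) hmono
  rw [hU, measure_univ] at h
  have h2 := (ENNReal.tendsto_toReal ENNReal.one_ne_top).comp h
  exact h2.eventually (lt_mem_nhds (by simpa using hc))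

/-- If a probability measure `l` is asymptotically close to the translates of `l'` by `ρ n`, in the
sense that the errors on every bounded test function are square summable, then `ρ` is square
summably close to a constant. -/
theorem exists_summable_sub_sq_of_translates (l l' : Measure ℝ) [IsProbabilityMeasure l]
    [IsProbabilityMeasure l'] (ρ : ℕ → ℝ)
    (h : ∀ k : ℝ → ℝ, Measurable k → (∀ s, |k s| ≤ 1) →
      Summable fun n => (∫ s, k s ∂l - ∫ s, k (s + ρ n) ∂l') ^ 2) :
    ∃ a : ℝ, Summable fun n => (ρ n - a) ^ 2 := by
  have htend : ∀ k : ℝ → ℝ, Measurable k → (∀ s, |k s| ≤ 1) →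
      Tendsto (fun n => ∫ s, k s ∂l - ∫ s, k (s + ρ n) ∂l') atTop (𝓝 0) := fun k hk hk1 => by
    have := (Real.continuous_sqrt.tendsto 0).comp (h k hk hk1).tendsto_atTop_zero
    simp only [Function.comp_def, Real.sqrt_sq_eq_abs, Real.sqrt_zero] at this
    exact (tendsto_zero_iff_abs_tendsto_zero _).2 this
  obtain ⟨R, hR⟩ : ∃ R : ℝ, ∀ᶠ n in atTop, ρ n ∈ Set.Icc (-R) R := by
    obtain ⟨M, hM, hM'⟩ := ((eventually_lt_measureReal_Icc l (c := 3 / 4) (by norm_num)).and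
      (eventually_lt_measureReal_Icc l' (c := 3 / 4) (by norm_num))).exists
    set I := Set.Icc (-M : ℝ) M with hI
    refine ⟨2 * M, ?_⟩
    -- Eventually `l'` gives mass above `3/4` to `I` and above `1/2` to its translate by `-ρ n`, so
    -- the two intervals meet and `|ρ n| ≤ 2 * M`.
    have h1 := htend (I.indicator fun _ => 1) (measurable_const.indicator measurableSet_Icc)
      fun s => by
        by_cases hs : s ∈ I <;> simp [hs]
    filter_upwards [h1.eventually (gt_mem_nhds (show (0 : ℝ) < 1 / 4 by norm_num))] with n hn
    have hpre : MeasurableSet ((fun s => s + ρ n) ⁻¹' I) := 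
      (measurable_add_const _) measurableSet_Icc
    have e : ∀ s, I.indicator (fun _ => (1 : ℝ)) (s + ρ n)
        = ((fun s => s + ρ n) ⁻¹' I).indicator (fun _ => 1) s := fun s => rfl
    simp only [e] at hn
    rw [integral_indicator_const _ measurableSet_Icc, integral_indicator_const _ hpre, smul_eq_mul,
      smul_eq_mul, mul_one, mul_one] at hn
    obtain ⟨s, hs1, hs2⟩ : (I ∩ ((fun s => s + ρ n) ⁻¹' I)).Nonempty := by
      by_contra hne
      rw [Set.not_nonempty_iff_eq_empty, ← Set.disjoint_iff_inter_eq_empty] at hne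
      have h2 := measureReal_union (μ := l') hne hpre
      have h3 : l'.real (I ∪ (fun s => s + ρ n) ⁻¹' I) ≤ 1 := measureReal_le_one
      linarith
    simp only [hI, Set.mem_preimage, Set.mem_Icc] at hs1 hs2
    exact ⟨by linarith, by linarith⟩
  obtain ⟨a, ha, φ, hφ, hφa⟩ := isCompact_Icc.tendsto_subseq' hR.frequently
  have hR0 : 0 ≤ R := by
    have := ha.1.trans ha.2
    linarith
  -- A small frequency keeps `charFun l' ξ` away from `0` and keeps the angles `ξ * (a - ρ n)` in
  -- `[-1, 1]`, where the sine is bounded below linearly.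
  obtain ⟨ξ, hξ0, hξR, hξ⟩ : ∃ ξ : ℝ, 0 < ξ ∧ ξ * (2 * R) < 1 ∧ 1 / 2 < ‖charFun l' ξ‖ := by
    have h1 : ∀ᶠ ξ : ℝ in 𝓝 0, ξ * (2 * R) < 1 :=
      (continuous_id.mul continuous_const).tendsto' 0 0 (by simp) |>.eventually
        (gt_mem_nhds one_pos)
    have h2 : ∀ᶠ ξ : ℝ in 𝓝 0, 1 / 2 < ‖charFun l' ξ‖ :=
      (continuous_charFun.norm).tendsto' 0 1 (by simp) |>.eventually
        (lt_mem_nhds (by norm_num))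
    obtain ⟨ξ, hξ, hξ'⟩ := (((h1.and h2).filter_mono nhdsWithin_le_nhds).and
      (self_mem_nhdsWithin (s := Set.Ioi (0 : ℝ)))).exists
    exact ⟨ξ, hξ', hξ.1, hξ.2⟩
  set D : ℕ → ℂ := fun n => charFun l ξ - Complex.exp ((ξ * ρ n : ℝ) * Complex.I) * charFun l' ξ
    with hD
  have hcos : Measurable fun s : ℝ => Real.cos (ξ * s) := by fun_prop
  have hsin : Measurable fun s : ℝ => Real.sin (ξ * s) := by fun_prop
  have hint : ∀ (m : Measure ℝ) [IsProbabilityMeasure m] (b : ℝ),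
      (∫ s, Real.cos (ξ * (s + b)) ∂m : ℝ) + (∫ s, Real.sin (ξ * (s + b)) ∂m : ℝ) * Complex.I
        = Complex.exp ((ξ * b : ℝ) * Complex.I) * charFun m ξ := fun m _ b => by
    have hc : Integrable (fun s => Real.cos (ξ * (s + b))) m :=
      Integrable.of_mem_Icc (-1) 1 (by fun_prop) (ae_of_all _ fun s => Real.cos_mem_Icc _)
    have hs : Integrable (fun s => Real.sin (ξ * (s + b))) m :=
      Integrable.of_mem_Icc (-1) 1 (by fun_prop) (ae_of_all _ fun s => Real.sin_mem_Icc _)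
    rw [charFun_apply_real, ← integral_const_mul, ← integral_complex_ofReal,
      ← integral_complex_ofReal, ← integral_mul_const, ← integral_add hc.ofReal
        (hs.ofReal.mul_const _)]
    congr 1 with s
    have e : ((ξ * b : ℝ) : ℂ) * Complex.I + ξ * s * Complex.I
        = ((ξ * (s + b) : ℝ) : ℂ) * Complex.I := by push_cast; ring
    rw [← Complex.exp_add, e, Complex.exp_mul_I, ← Complex.ofReal_cos, ← Complex.ofReal_sin]
  have hDsq : ∀ n, ‖D n‖ ^ 2
      = (∫ s, Real.cos (ξ * s) ∂l - ∫ s, Real.cos (ξ * (s + ρ n)) ∂l') ^ 2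
        + (∫ s, Real.sin (ξ * s) ∂l - ∫ s, Real.sin (ξ * (s + ρ n)) ∂l') ^ 2 := fun n => by
    have e0 := hint l 0
    simp only [add_zero, mul_zero, Complex.ofReal_zero, zero_mul, Complex.exp_zero, one_mul] at e0
    have e1 : D n = ((∫ s, Real.cos (ξ * s) ∂l - ∫ s, Real.cos (ξ * (s + ρ n)) ∂l' : ℝ) : ℂ)
        + ((∫ s, Real.sin (ξ * s) ∂l - ∫ s, Real.sin (ξ * (s + ρ n)) ∂l' : ℝ) : ℂ)
          * Complex.I := by
      simp only [hD]
      rw [← e0, ← hint l' (ρ n)]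
      push_cast
      ring
    rw [e1, Complex.sq_norm, Complex.normSq_add_mul_I]
  have hDsum : Summable fun n => ‖D n‖ ^ 2 := by
    simp only [hDsq]
    exact (h _ hcos fun s => Real.abs_cos_le_one _).add (h _ hsin fun s => Real.abs_sin_le_one _)
  have hD0 : Tendsto D atTop (𝓝 0) := by
    rw [tendsto_zero_iff_norm_tendsto_zero]
    have := (Real.continuous_sqrt.tendsto 0).comp hDsum.tendsto_atTop_zero
    simpa [Function.comp_def, Real.sqrt_sq] using this
  -- The limit along the subsequence gives this identity, so `D n` factors through `exp (i ξ (a - ρ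
  -- n)) - 1`, whose modulus controls `|ρ n - a|`.
  have hlim : charFun l ξ = Complex.exp ((ξ * a : ℝ) * Complex.I) * charFun l' ξ := by
    have h1 := hD0.comp hφ.tendsto_atTop
    have hcont : Continuous fun b : ℝ =>
        charFun l ξ - Complex.exp ((ξ * b : ℝ) * Complex.I) * charFun l' ξ := by fun_prop
    have h2 := (hcont.tendsto a).comp hφa
    exact sub_eq_zero.1 (tendsto_nhds_unique h2 h1)
  refine ⟨a, Summable.of_norm_bounded_eventually_nat
    (hDsum.mul_left ((Real.pi / ξ) ^ 2)) ?_⟩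
  filter_upwards [hR] with n hn
  have hx : |ξ * (a - ρ n)| ≤ 1 := by
    rw [abs_mul, abs_of_pos hξ0]
    have : |a - ρ n| ≤ 2 * R := abs_le.2 ⟨by linarith [ha.1, hn.2], by linarith [ha.2, hn.1]⟩
    exact (mul_le_mul_of_nonneg_left this hξ0.le).trans hξR.le
  have h1 : D n = Complex.exp ((ξ * ρ n : ℝ) * Complex.I) *
      (Complex.exp ((ξ * (a - ρ n) : ℝ) * Complex.I) - 1) * charFun l' ξ := by
    simp only [hD]
    rw [hlim, mul_sub, ← Complex.exp_add, ← add_mul, ← Complex.ofReal_add]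
    ring_nf
  have h2 : 2 / Real.pi * |ξ * (a - ρ n)|
      ≤ ‖Complex.exp ((ξ * (a - ρ n) : ℝ) * Complex.I) - 1‖ := by
    refine (Real.mul_abs_le_abs_sin (hx.trans (by linarith [Real.two_le_pi]))).trans ?_
    refine le_trans (le_of_eq ?_) (Complex.abs_im_le_norm _)
    rw [Complex.sub_im, Complex.exp_ofReal_mul_I_im, Complex.one_im, sub_zero]
  have h3 : 1 / Real.pi * (ξ * |ρ n - a|) ≤ ‖D n‖ := by
    rw [h1, norm_mul, norm_mul, Complex.norm_exp_ofReal_mul_I, one_mul]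
    calc 1 / Real.pi * (ξ * |ρ n - a|) = 2 / Real.pi * |ξ * (a - ρ n)| * (1 / 2) := by
          rw [abs_mul, abs_of_pos hξ0, abs_sub_comm]; ring
      _ ≤ _ := mul_le_mul h2 hξ.le (by norm_num) (norm_nonneg _)
  have hpi := Real.pi_pos
  rw [Real.norm_of_nonneg (sq_nonneg _), ← sq_abs (ρ n - a), ← mul_pow]
  refine pow_le_pow_left₀ (abs_nonneg _) ?_ 2
  calc |ρ n - a| = Real.pi / ξ * (1 / Real.pi * (ξ * |ρ n - a|)) := by field_simp
    _ ≤ _ := mul_le_mul_of_nonneg_left h3 (by positivity)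

/-- Invariant product measures of two weighted shifts are mutually singular unless the ratios of
the products of the weights are square summably close to a constant. -/
theorem squareSummableRatio_of_not_mutuallySingular {𝕜 : Type*} [RCLike 𝕜] {u v : ℕ → 𝕜}
    (hu : IsWeightSequence u) (hv : IsWeightSequence v) {μ ν : ℕ → Measure 𝕜}
    [∀ n, IsProbabilityMeasure (μ n)] [∀ n, IsProbabilityMeasure (ν n)]
    (hμ : ∀ n, (μ n).map (fun t => weightProd u n * t) = μ 0)
    (hν : ∀ n, (ν n).map (fun t => weightProd v n * t) = ν 0) (hν0 : ν 0 {0} = 0)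
    (hsing : ¬ Measure.infinitePi μ ⟂ₘ Measure.infinitePi ν) :
    SquareSummableRatio u v := by
  set r : ℕ → ℝ := fun n => ‖weightProd u n / weightProd v n‖ with hr
  have hr0 : ∀ n, 0 < r n := fun n =>
    norm_pos_iff.2 (div_ne_zero (weightProd_ne_zero hu n) (weightProd_ne_zero hv n))
  have hlog : Measurable fun t : 𝕜 => Real.log ‖t‖ := by fun_prop
  have h1 : IsProbabilityMeasure ((μ 0).map fun t => Real.log ‖t‖) :=
    Measure.isProbabilityMeasure_map hlog.aemeasurable
  have h2 : IsProbabilityMeasure ((ν 0).map fun t => Real.log ‖t‖) :=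
    Measure.isProbabilityMeasure_map hlog.aemeasurable
  obtain ⟨a, ha⟩ := exists_summable_sub_sq_of_translates ((μ 0).map fun t => Real.log ‖t‖)
    ((ν 0).map fun t => Real.log ‖t‖) (fun n => Real.log (r n)) fun k hk hk1 => by
      by_contra hns
      -- The test functions use the products of `u` for both measures: this freezes the law under `μ
      -- n` and leaves a translation under `ν n`.
      refine hsing (mutuallySingular_infinitePi_of_not_summable μ ν
        (h := fun n t => k (Real.log ‖weightProd u n * t‖)) (fun n => by fun_prop)
        (fun n t => hk1 _) fun hs => hns (hs.congr fun n => ?_))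
      have e1 : ∫ t, k (Real.log ‖weightProd u n * t‖) ∂μ n
          = ∫ s, k s ∂(μ 0).map fun t => Real.log ‖t‖ := by
        rw [integral_map hlog.aemeasurable hk.aestronglyMeasurable]
        have hkl : Measurable fun t : 𝕜 => k (Real.log ‖t‖) := by fun_prop
        rw [← hμ n, integral_map (by fun_prop) hkl.aestronglyMeasurable]
      have e2 : ∫ t, k (Real.log ‖weightProd u n * t‖) ∂ν n
          = ∫ s, k (s + Real.log (r n)) ∂(ν 0).map fun t => Real.log ‖t‖ := by
        have hk' : Measurable fun s => k (s + Real.log (r n)) := by fun_prop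
        rw [integral_map hlog.aemeasurable hk'.aestronglyMeasurable]
        have e3 : ∀ t : 𝕜, ‖weightProd u n * t‖ = r n * ‖weightProd v n * t‖ := fun t => by
          rw [hr, ← norm_mul]
          congr 1
          have := weightProd_ne_zero hv n
          field_simp
        have hkr : Measurable fun t : 𝕜 => k (Real.log (r n * ‖t‖)) := by fun_prop
        simp only [e3]
        rw [← integral_map (μ := ν n) (φ := fun t => weightProd v n * t) (by fun_prop)
          hkr.aestronglyMeasurable, hν n]
        refine integral_congr_ae ?_
        filter_upwards [measure_eq_zero_iff_ae_notMem.1 hν0] with t ht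
        rw [Real.log_mul (hr0 n).ne' (norm_ne_zero_iff.2 ht), add_comm]
      rw [e1, e2]
  refine ⟨Real.exp (-a), Real.exp_pos _, ?_⟩
  -- Near the limit, `κ * r n = exp (log (r n) - a)` and `|exp x - 1| ≤ 2 |x|` for `|x| ≤ 1`.
  refine (summable_nat_add_iff (f := fun n => (1 - Real.exp (-a) * r n) ^ 2) 1).2 ?_
  refine Summable.of_norm_bounded_eventually_nat (ha.mul_left 4) ?_
  filter_upwards [ha.tendsto_atTop_zero.eventually (gt_mem_nhds one_pos)] with n hn
  have hx : |Real.log (r n) - a| ≤ 1 := ((sq_lt_one_iff_abs_lt_one _).1 hn).le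
  have h3 := Real.abs_exp_sub_one_le hx
  have h4 : Real.exp (-a) * r n = Real.exp (Real.log (r n) - a) := by
    rw [sub_eq_neg_add, Real.exp_add, Real.exp_log (hr0 n)]
  rw [Real.norm_of_nonneg (sq_nonneg _), h4, ← sq_abs, abs_sub_comm, ← sq_abs (Real.log (r n) - a)]
  calc |Real.exp (Real.log (r n) - a) - 1| ^ 2 ≤ (2 * |Real.log (r n) - a|) ^ 2 := by gcongr
    _ = _ := by ring

/-! ### The equivalences -/

theorem summable_norm_div_weightProd_rpow {𝕜 : Type*} [RCLike 𝕜] {p : ℝ≥0∞}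
    {w : ℕ → 𝕜} (h : InvProdSummable p w) (κ : ℝ) :
    Summable fun n => ‖κ / ‖weightProd w n‖‖ ^ p.toReal := by
  rw [← summable_nat_add_iff 1]
  refine (Summable.mul_left (‖κ‖ ^ p.toReal) h).congr fun n => ?_
  rw [norm_div, norm_norm, Real.div_rpow (norm_nonneg _) (norm_nonneg _), mul_one_div]

section Equivalences

variable {𝕜 : Type*} [RCLike 𝕜] {p : ℝ≥0∞} [Fact (1 ≤ p)]

theorem IsProductMeasureWith.mono {Q R : Measure 𝕜 → Prop} (h : ∀ μ, Q μ → R μ)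
    {m : Measure (Ellp 𝕜 p)} (hm : IsProductMeasureWith Q m) : IsProductMeasureWith R m := by
  obtain ⟨μ, hμ, hmap, hQ⟩ := hm
  exact ⟨μ, hμ, hmap, fun n => h _ (hQ n)⟩

theorem IsLebesgueAC.measure_zero {μ : Measure 𝕜} (h : IsLebesgueAC μ) : μ {0} = 0 :=
  h (measure_singleton 0)

theorem IsCenteredIsotropicGaussian.isLebesgueAC {μ : Measure 𝕜}
    (h : IsCenteredIsotropicGaussian μ) : IsLebesgueAC μ := by
  obtain ⟨σ, hσ, rfl⟩ := h
  exact isotropicGaussian_absolutelyContinuous hσ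

theorem IsCenteredIsotropicGaussian.isLogL2 {μ : Measure 𝕜}
    (h : IsCenteredIsotropicGaussian μ) : IsLogL2 μ := by
  refine ⟨h.isLebesgueAC.measure_zero, ?_⟩
  obtain ⟨σ, hσ, rfl⟩ := h
  exact memLp_log_norm_isotropicGaussian hσ

/-- A measure both absolutely continuous and singular with respect to another vanishes, which a
probability measure does not. -/
theorem not_orthogonalWrt_of_admitEquivalentGaussianProducts {T₁ T₂ : Ellp 𝕜 p → Ellp 𝕜 p}
    (h : AdmitEquivalentGaussianProducts T₁ T₂) {Q : Measure 𝕜 → Prop}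
    (hQ : ∀ μ, IsCenteredIsotropicGaussian μ → Q μ) :
    ¬ OrthogonalWrt (IsProductMeasureWith Q) T₁ T₂ := by
  obtain ⟨m₁, m₂, h₁, h₂, hT₁, hT₂, hm₁, hm₂, hac, -⟩ := h
  intro ho
  have hs := ho m₁ m₂ h₁ h₂ hT₁ hT₂ (hm₁.mono hQ) (hm₂.mono hQ)
  exact IsProbabilityMeasure.ne_zero m₁
    (Measure.eq_zero_of_absolutelyContinuous_of_mutuallySingular hac hs)

theorem squareSummableRatio_and_invProdSummable_of_not_orthogonalWrt (hp : p ≠ ∞) {u v : ℕ → 𝕜}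
    {hu : IsWeightSequence u} {hv : IsWeightSequence v} {Q : Measure 𝕜 → Prop}
    (hQ : ∀ μ, Q μ → μ {0} = 0)
    (h : ¬ OrthogonalWrt (IsProductMeasureWith Q) (weightedShift p u hu) (weightedShift p v hv)) :
    SquareSummableRatio u v ∧ InvProdSummable p u ∧ InvProdSummable p v := by
  unfold OrthogonalWrt at h
  push Not at h
  obtain ⟨m₁, m₂, h₁, h₂, hT₁, hT₂, ⟨μ, hμ, hmμ, hQμ⟩, ⟨ν, hν, hmν, hQν⟩, hns⟩ := h
  refine ⟨squareSummableRatio_of_not_mutuallySingular hu hv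
    (map_weightProd_mul_marginal hT₁ hmμ) (map_weightProd_mul_marginal hT₂ hmν)
    (hQ _ (hQν 0)) fun hs => hns ?_, invProdSummable_of_invariant hp hT₁ hmμ (hQ _ (hQμ 0)),
    invProdSummable_of_invariant hp hT₂ hmν (hQ _ (hQν 0))⟩
  rw [← hmμ, ← hmν] at hs
  obtain ⟨s, hs, hs1, hs2⟩ := hs
  have hm := measurable_ellpIncl 𝕜 p
  rw [Measure.map_apply hm hs] at hs1
  rw [Measure.map_apply hm hs.compl] at hs2
  exact ⟨_, hm hs, hs1, hs2⟩

theorem isotropicGaussian_marginal_step {w : ℕ → 𝕜} (hw : IsWeightSequence w) (κ : ℝ) (n : ℕ) :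
    (isotropicGaussian 𝕜 (κ / ‖weightProd w (n + 1)‖)).map (fun t => w (n + 1) * t)
      = isotropicGaussian 𝕜 (κ / ‖weightProd w n‖) := by
  rw [isotropicGaussian_map_mul, weightProd_succ, norm_mul]
  congr 1
  have h1 := norm_ne_zero_iff.2 (weightProd_ne_zero hw n)
  have h2 := norm_ne_zero_iff.2 (hw.ne_zero (n + 1) (by omega))
  field_simp

theorem admitEquivalentGaussianProducts_of_squareSummableRatio (hp : p ≠ ∞) {u v : ℕ → 𝕜}
    {hu : IsWeightSequence u} {hv : IsWeightSequence v} (h : SquareSummableRatio u v)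
    (hsu : InvProdSummable p u) (hsv : InvProdSummable p v) :
    AdmitEquivalentGaussianProducts (weightedShift p u hu) (weightedShift p v hv) := by
  obtain ⟨κ, hκ, hsum⟩ := h
  set σ : ℕ → ℝ := fun n => 1 / ‖weightProd u n‖ with hσ
  set τ : ℕ → ℝ := fun n => κ / ‖weightProd v n‖ with hτ
  have hu0 : ∀ n, 0 < ‖weightProd u n‖ := fun n => norm_pos_iff.2 (weightProd_ne_zero hu n)
  have hv0 : ∀ n, 0 < ‖weightProd v n‖ := fun n => norm_pos_iff.2 (weightProd_ne_zero hv n)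
  have hσ0 : ∀ n, 0 < σ n := fun n => div_pos one_pos (hu0 n)
  have hτ0 : ∀ n, 0 < τ n := fun n => div_pos hκ (hv0 n)
  obtain ⟨hP₁, hT₁, hm₁⟩ := exists_invariant_of_marginals hp hu
    (isotropicGaussian_marginal_step hu 1)
    (ae_mem_range_ellpIncl_isotropicGaussian hp (summable_norm_div_weightProd_rpow hsu 1))
  obtain ⟨hP₂, hT₂, hm₂⟩ := exists_invariant_of_marginals hp hv
    (isotropicGaussian_marginal_step hv κ)
    (ae_mem_range_ellpIncl_isotropicGaussian hp (summable_norm_div_weightProd_rpow hsv κ))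
  have hdist : Summable fun n => (σ n - τ n) ^ 2 / (σ n ^ 2 + τ n ^ 2) := by
    refine Summable.of_nonneg_of_le (fun n => by positivity) (fun n => ?_)
      ((summable_nat_add_iff (f := fun n =>
        (1 - κ * ‖weightProd u n / weightProd v n‖) ^ 2) 1).1 hsum)
    -- The ratio `τ n / σ n` is exactly `κ` times the ratio of the weight products; dropping `τ n ^
    -- 2` from the denominator then bounds the summand by the term of (c).
    have e : 1 - κ * ‖weightProd u n / weightProd v n‖ = (σ n - τ n) / σ n := by
      have := (hu0 n).ne'
      have := (hv0 n).ne'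
      rw [norm_div, hσ, hτ]
      field_simp
    rw [e, div_pow (σ n - τ n)]
    have := hσ0 n
    gcongr
    exact le_add_of_nonneg_right (sq_nonneg _)
  have hcomap : ∀ {P Q : Measure (ℕ → 𝕜)}, P ≪ Q →
      P.comap (ellpIncl 𝕜 p) ≪ Q.comap (ellpIncl 𝕜 p) := fun {P Q} hPQ s hs => by
    rw [(measurableEmbedding_ellpIncl hp).comap_apply] at hs ⊢
    exact hPQ hs
  refine ⟨_, _, hP₁, hP₂, hT₁, hT₂, ⟨_, inferInstance, hm₁, fun n => ⟨σ n, hσ0 n, rfl⟩⟩,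
    ⟨_, inferInstance, hm₂, fun n => ⟨τ n, hτ0 n, rfl⟩⟩, ?_, ?_⟩
  · exact hcomap (infinitePi_isotropicGaussian_absolutelyContinuous hσ0 hτ0 hdist)
  · refine hcomap (infinitePi_isotropicGaussian_absolutelyContinuous hτ0 hσ0
      (hdist.congr fun n => ?_))
    rw [add_comm, ← neg_sub, neg_sq]

end Equivalences

theorem corollary6p9 {𝕜 : Type*} [RCLike 𝕜] (p : ℝ≥0∞) [Fact (1 ≤ p)] (hp : p ≠ ⊤)
    (u v : ℕ → 𝕜) (hu : IsWeightSequence u) (hv : IsWeightSequence v) :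
    -- under the summability condition, the four properties are equivalent
    (InvProdSummable p u → InvProdSummable p v →
      List.TFAE [
        ¬ OrthogonalWrt (IsProductMeasureWith IsLebesgueAC)
            (weightedShift p u hu) (weightedShift p v hv),
        ¬ OrthogonalWrt (IsProductMeasureWith IsLogL2)
            (weightedShift p u hu) (weightedShift p v hv),
        SquareSummableRatio u v,
        AdmitEquivalentGaussianProducts (weightedShift p u hu) (weightedShift p v hv)]) ∧
    -- without it, the three properties about measures are equivalent and imply the third one
    List.TFAE [
      ¬ OrthogonalWrt (IsProductMeasureWith IsLebesgueAC)
          (weightedShift p u hu) (weightedShift p v hv),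
      ¬ OrthogonalWrt (IsProductMeasureWith IsLogL2)
          (weightedShift p u hu) (weightedShift p v hv),
      AdmitEquivalentGaussianProducts (weightedShift p u hu) (weightedShift p v hv)] ∧
    (AdmitEquivalentGaussianProducts (weightedShift p u hu) (weightedShift p v hv) →
      SquareSummableRatio u v) := by

  have hda := fun h => not_orthogonalWrt_of_admitEquivalentGaussianProducts
    (T₁ := weightedShift p u hu) (T₂ := weightedShift p v hv) h
    (fun (μ : Measure 𝕜) => IsCenteredIsotropicGaussian.isLebesgueAC)
  have hdb := fun h => not_orthogonalWrt_of_admitEquivalentGaussianProducts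
    (T₁ := weightedShift p u hu) (T₂ := weightedShift p v hv) h
    (fun (μ : Measure 𝕜) => IsCenteredIsotropicGaussian.isLogL2)
  have hac := squareSummableRatio_and_invProdSummable_of_not_orthogonalWrt hp (hu := hu) (hv := hv)
    (fun (μ : Measure 𝕜) => IsLebesgueAC.measure_zero)
  have hbc := squareSummableRatio_and_invProdSummable_of_not_orthogonalWrt hp (hu := hu) (hv := hv)
    (fun (μ : Measure 𝕜) (h : IsLogL2 μ) => h.1)
  have hcd := admitEquivalentGaussianProducts_of_squareSummableRatio hp (hu := hu) (hv := hv)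
  refine ⟨fun hsu hsv => ?_, ?_, fun h => (hac (hda h)).1⟩
  · tfae_have 1 → 3 := fun h => (hac h).1
    tfae_have 2 → 3 := fun h => (hbc h).1
    tfae_have 3 → 4 := fun h => hcd h hsu hsv
    tfae_have 4 → 1 := hda
    tfae_have 4 → 2 := hdb
    tfae_finish
  -- Here the two summability conditions come from the invariant measures themselves.
  · tfae_have 1 → 3 := fun h => hcd (hac h).1 (hac h).2.1 (hac h).2.2
    tfae_have 2 → 3 := fun h => hcd (hbc h).1 (hbc h).2.1 (hbc h).2.2
    tfae_have 3 → 1 := hda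
    tfae_have 3 → 2 := hdb
    tfae_finish
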